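/- A cellular automaton on $A^{\mathbb Z}$ ($A$ a finite set) is a map $F:A^{\mathbb Z}\to A^{\mathbb Z}$ given by a local rule on a finite neighbourhood, i.e. $F(x)_m=f\big((x_{m+u})_{r\le u\le s}\big)$ for some integers $r,s$ and some map $f:A^{\{r,\dots,s\}}\to A$. Let $d_C(x,y)=2^{-\min\{|i|\,:\,x_i\neq y_i\}}$ (and $d_C(x,x)=0$), let $\sigma$ be the shift, $\sigma(x)_i=x_{i+1}$, and let $\mathcal F$ be the set of all $h:\mathbb N\to\mathbb Z$ for which $|h(n+1)-h(n)|$ is bounded. For $h\in\mathcal F$, a point $x\in A^{\mathbb Z}$ is equicontinuous along $h$ if for every $\varepsilon>0$ there is $\delta>0$ such that every $y\in A^{\mathbb Z}$ with $d_C(x,y)<\delta$ satisfies $d_C\big(\sigma^{h(n)}F^n(x),\sigma^{h(n)}F^n(y)\big)<\varepsilon$ for all $n\in\mathbb N$; let $\mathbf A_{\mathbb N}(A^{\mathbb Z},F)$ be the set of those $h\in\mathcal F$ along which $F$ has at least one equicontinuous point. Write $h\precsim k$ if there is $M>0$ with $h(n)\le k(n)+M$ for all $n\in\mathbb N$, let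 $\mathbf 0$ be the constant function $n\mapsto 0$, and let $$p(n)=\left\lfloor\frac{\sqrt{1+4(n+1)}-1}{2}\right\rfloor\qquad(n\in\mathbb N).$$ **Proposition.** There exist a finite set $A$ and a cellular automaton $F_C$ on $A^{\mathbb Z}$ such that $$\mathbf A_{\mathbb N}(A^{\mathbb Z},F_C)=\{h\in\mathcal F:\ \mathbf 0\precsim h\precsim p\},$$ and such that, moreover, there is a letter $a\in A$ whose cone of consequences is exactly the region between the vertical axis and the parabola: $$\big\{(m,n)\in\mathbb Z\times\mathbb N:\ F_C^n(x)_m=F_C^n(y)_m\text{ for all }x,y\in A^{\mathbb Z}\text{ with }x_0=y_0=a\big\}=\{(m,n)\in\mathbb Z\times\mathbb N:\ 0\le m\le p(n)\}.$$ -/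

import Mathlib

namespace CurveDynamics

open SymbolicDynamics.FullShift (shift)

noncomputable section

/-- `F` is (the global map of) a cellular automaton on `A^ℤ`: there are a neighbourhood
`⟦r, s⟧ ⊂ ℤ` and a local rule `f : A^⟦r, s⟧ → A` with `F(x)_m = f((x_{m+u})_{u ∈ ⟦r, s⟧})`. -/
def IsCellularAutomaton {A : Type*} (F : (ℤ → A) → (ℤ → A)) : Prop :=
  ∃ (r s : ℤ) (f : (Set.Icc r s → A) → A),
    ∀ (x : ℤ → A) (m : ℤ), F x m = f fun u => x (m + (u : ℤ))

open Classical in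
/-- The distance `d_C(x, y) = 2 ^ (- min {|i| : x_i ≠ y_i})` on `A^ℤ` (and `0` if `x = y`). -/
def cantorDist {A : Type*} (x y : ℤ → A) : ℝ :=
  if x = y then 0 else (2 : ℝ)⁻¹ ^ sInf {n : ℕ | ∃ i : ℤ, i.natAbs = n ∧ x i ≠ y i}

/-- The ball, relative to `S ⊆ A^ℤ`, with centre `x` and radius `ε`. -/
def relBall {A : Type*} (S : Set (ℤ → A)) (x : ℤ → A) (ε : ℝ) : Set (ℤ → A) :=
  {y | y ∈ S ∧ cantorDist x y < ε}

/-- The tube along `h : ℕ → ℤ`, relative to `S ⊆ A^ℤ`, with centre `x` and radius `ε`.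
Here `shift m` is the `m`-th power of the shift, `(shift m x)_i = x_{m+i}`. -/
def tube {A : Type*} (S : Set (ℤ → A)) (F : (ℤ → A) → (ℤ → A)) (h : ℕ → ℤ)
    (x : ℤ → A) (ε : ℝ) : Set (ℤ → A) :=
  {y | y ∈ S ∧ ∀ n : ℕ, cantorDist (shift (h n) (F^[n] x)) (shift (h n) (F^[n] y)) < ε}

/-- The set of `(ℕ, S)`-equicontinuous points of `F` along `h`. -/
def equicontinuousPoints {A : Type*} (S : Set (ℤ → A)) (F : (ℤ → A) → (ℤ → A))
    (h : ℕ → ℤ) : Set (ℤ → A) :=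
  {x | x ∈ S ∧ ∀ ε : ℝ, 0 < ε → ∃ δ : ℝ, 0 < δ ∧ relBall S x δ ⊆ tube S F h x ε}

/-- The set of curves `h : ℕ → ℤ` with bounded variation. -/
def boundedVariationCurves : Set (ℕ → ℤ) :=
  {h | ∃ M : ℤ, 0 < M ∧ ∀ n : ℕ, |h (n + 1) - h n| ≤ M}

/-- The set `A_ℕ(S, F)` of the curves with bounded variation along which `F` has an
equicontinuous point. -/
def equicontinuousCurves {A : Type*} (S : Set (ℤ → A)) (F : (ℤ → A) → (ℤ → A)) :
    Set (ℕ → ℤ) :=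
  {h | h ∈ boundedVariationCurves ∧ (equicontinuousPoints S F h).Nonempty}

/-- The relation `h ≾ k`: `h` is at most `k` up to an additive constant. -/
def CurveLE (h k : ℕ → ℤ) : Prop :=
  ∃ M : ℤ, 0 < M ∧ ∀ n : ℕ, h n ≤ k n + M

/-- The cylinder `[w]_i` of the configurations that carry the word `w` from position `i` on. -/
def wordCylinder {A : Type*} (w : List A) (i : ℤ) : Set (ℤ → A) :=
  {x | ∀ j : Fin w.length, x (i + (j.val : ℤ)) = w.get j}

/-- The region of consequences of a set `X` of configurations: the sites `(m, n) ∈ ℤ × ℕ`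
(space, time) whose colour is the same in all space-time diagrams generated by points of `X`. -/
def consequences {A : Type*} (F : (ℤ → A) → (ℤ → A)) (X : Set (ℤ → A)) : Set (ℤ × ℕ) :=
  {s | ∀ x ∈ X, ∀ y ∈ X, shift s.1 (F^[s.2] x) 0 = shift s.1 (F^[s.2] y) 0}

/-- The discrete parabola `p(n) = ⌊(√(1 + 4(n + 1)) - 1) / 2⌋`. -/
def parabola (n : ℕ) : ℤ :=
  ⌊(Real.sqrt (1 + 4 * ((n : ℝ) + 1)) - 1) / 2⌋

end

end CurveDynamics

/-! Each seed starts a solid segment that grows to the right along the parabola; the difficulty is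
to protect this growth from an arbitrary initial configuration.

Growth (`inner`): a signal bounces between the solid segment and a mark. Each turn at the mark
pushes the mark two sites away, and each return adds one solid cell. With `k` solid cells a round
trip lasts `2k + 2` steps, so cell number `k + 1` is added at time `(k + 1)(k + 2) - 1`, which is
the parabola (`le_parabola_iff`). Another seed on the right reflects the signal earlier, which only
speeds up the growth until the space up to that seed is filled (`Phase`). So the sites from `j` to
`j + p(n)` are solid whatever surrounds the seed `j` (`eq_solidCell`), and a last seed on the right
yields nothing beyond them (`Phase.le_parabola`).

Protection (`collide`): regions compete by age. A seed emits a core growing at speed 1, in which the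
signal lives, and on either side a front (speed 3) and a back (speed 2). A lethal front erases
cores. Two crossing fronts become harmless, and a harmless front dies at a core. When a back meets
the opposing front, it sends a pulse (speed 7) after its own front, to make it lethal again. The
distance from pulse to front closes at speed 4, and so does the distance from the front to an
opposing growing core; hence the pulse comes in time exactly when that core lies far behind its own
front, that is, when it is old. Remnants of the initial configuration have aged by 14 collision
steps when the seeds emit: their cores lie at least `2t + 29` behind a front, those of the seeds `2t
+ 12`. So the fronts of seeds clear the remnants away, while no front becomes lethal in time to harm
the core of a seed. This is the invariant `Inv`, established by `inv_emit` and preserved by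
`Inv.step`.

Both claims of the theorem follow by comparing configurations: the region forced by seeds is solid
in all of them, and outside it one more seed makes a visible difference (`iterate_update_ne`). -/

namespace CurveDynamics

namespace ParabolaCA

/-- The components of a cell. A *core* cell may carry the components of the inner automaton (a
`solid` cell, a signal running right or left, or a mark). Outside the core there are particles
running right (`r`) or left (`l`): lethal fronts, harmless fronts, backs and pulses. -/
inductive Fld
  | core | solid | sigR | sigL | mark | seed
  | rLethal | rHarmless | rBack | rPulse
  | lLethal | lHarmless | lBack | lPulse

instance : Fintype Fld where
  elems := ⟨([.core, .solid, .sigR, .sigL, .mark, .seed, .rLethal, .rHarmless, .rBack, .rPulse,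
    .lLethal, .lHarmless, .lBack, .lPulse] : List Fld), by simp⟩
  complete f := by cases f <;> simp

/-- Exchange of left and right. -/
def Fld.swap : Fld → Fld
  | rLethal => lLethal | rHarmless => lHarmless | rBack => lBack | rPulse => lPulse
  | lLethal => rLethal | lHarmless => rHarmless | lBack => rBack | lPulse => rPulse
  | f => f

abbrev Cell := Fld → Prop

abbrev Cfg := ℤ → Cell

/-- The mirror image of a configuration. -/
def mir (x : Cfg) : Cfg := fun m f => x (-m) f.swap

theorem mir_mir (x : Cfg) : mir (mir x) = x := by
  funext m f
  cases f <;> simp [mir, Fld.swap]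

/-- The predicate `φ` holds somewhere in the interval `[lo, hi]`. -/
def Within (φ : ℤ → Prop) (lo hi : ℤ) : Prop := ∃ q, lo ≤ q ∧ q ≤ hi ∧ φ q

/-! ### The collision step -/

def rFront (x : Cfg) (m : ℤ) : Prop := x m .rLethal ∨ x m .rHarmless

def lFront (x : Cfg) (m : ℤ) : Prop := x m .lLethal ∨ x m .lHarmless

def lethal (x : Cfg) (m : ℤ) : Prop := x m .rLethal ∨ x m .lLethal

/-- The window has length 4 because a front and a core growing towards it approach by 3 + 1 sites
per step. -/
def surv (x : Cfg) (y : ℤ) : Prop :=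
  x y .rLethal ∨ (x y .rHarmless ∧ ¬ Within (fun q => x q .core) y (y + 4))

/-- Two opposing fronts approach by 6 sites per step, so these are the fronts met or passed during
the step. -/
def cross (x : Cfg) (y : ℤ) : Prop :=
  Within (fun z => surv (mir x) (-z)) (y + 1) (y + 6)

/-- A pulse gains 7 - 3 = 4 sites per step on its front: these pulses catch up during the step. -/
def hot (x : Cfg) (y : ℤ) : Prop :=
  x y .rLethal ∨ Within (fun u => x u .rPulse) (y - 4) y

def newCore (x : Cfg) (m : ℤ) : Prop :=
  Within (fun q => x q .core) (m - 1) (m + 1) ∧ ¬ Within (lethal x) (m - 8) (m + 8)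

def newLethal (x : Cfg) (m : ℤ) : Prop :=
  surv x (m - 3) ∧ hot x (m - 3) ∧ ¬ cross x (m - 3)

def newHarmless (x : Cfg) (m : ℤ) : Prop :=
  surv x (m - 3) ∧ (cross x (m - 3) ∨ ¬ hot x (m - 3))

/-- A front erases a back that it catches on the same site. Hence a back found behind a front has
been behind it from the outset, and their distance bounds the age. -/
def newBack (x : Cfg) (m : ℤ) : Prop :=
  x (m - 2) .rBack ∧ ¬ rFront x (m - 3) ∧ ¬ Within (fun q => x q .core) (m - 2) (m + 1)

/-- Pulses do not pass opposing fronts, so a pulse behind the front of a seed cannot have come in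
from outside. New pulses start at a back that meets an opposing front. -/
def newPulse (x : Cfg) (m : ℤ) : Prop :=
  (x (m - 7) .rPulse ∧ ¬ Within (fun q => x q .core) (m - 7) (m + 1) ∧
      ¬ Within (lFront x) (m - 6) (m + 7)) ∨
    (newBack x m ∧ Within (lFront x) (m - 1) (m + 3))

/-- One step of the motion and of the collisions of the particles. -/
def collide (x : Cfg) : Cfg := fun m f =>
  match f with
  | .core => newCore x m
  | .solid => x m .solid ∧ x m .core ∧ newCore x m
  | .sigR => x m .sigR ∧ x m .core ∧ newCore x m
  | .sigL => x m .sigL ∧ x m .core ∧ newCore x m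
  | .mark => x m .mark ∧ x m .core ∧ newCore x m
  | .seed => x m .seed
  | .rLethal => newLethal x m
  | .rHarmless => newHarmless x m
  | .rBack => newBack x m
  | .rPulse => newPulse x m
  | .lLethal => newLethal (mir x) (-m)
  | .lHarmless => newHarmless (mir x) (-m)
  | .lBack => newBack (mir x) (-m)
  | .lPulse => newPulse (mir x) (-m)

theorem within_neg (φ : ℤ → Prop) (lo hi : ℤ) :
    Within (fun q => φ (-q)) lo hi ↔ Within φ (-hi) (-lo) := by
  constructor
  · rintro ⟨q, h1, h2, h3⟩
    exact ⟨-q, by omega, by omega, h3⟩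
  · rintro ⟨q, h1, h2, h3⟩
    exact ⟨-q, by omega, by omega, by simpa using h3⟩

theorem newCore_mir (x : Cfg) (m : ℤ) : newCore (mir x) m ↔ newCore x (-m) := by
  have h1 := within_neg (fun q => x q .core) (m - 1) (m + 1)
  have h2 := within_neg (lethal x) (m - 8) (m + 8)
  have e : lethal (mir x) = fun q => lethal x (-q) := by
    funext q
    simp [lethal, mir, Fld.swap, or_comm]
  unfold newCore
  rw [e, h2]
  simp only [mir, Fld.swap]
  rw [h1]
  rw [show -(m + 1) = -m - 1 by ring, show -(m - 1) = -m + 1 by ring,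
    show -(m + 8) = -m - 8 by ring, show -(m - 8) = -m + 8 by ring]

/-- Thanks to this symmetry only the right-hand sides of the seeds are treated below. -/
theorem collide_mir (x : Cfg) : collide (mir x) = mir (collide x) := by
  funext m f
  have h := propext (newCore_mir x m)
  have hL : ∀ g : Cfg → ℤ → Prop, g (mir (mir x)) (-m) = g x (-m) := fun g => by rw [mir_mir]
  cases f
  case core => exact h
  case seed => rfl
  case rLethal => exact congrArg (newLethal (mir x)) (neg_neg m).symm
  case rHarmless => exact congrArg (newHarmless (mir x)) (neg_neg m).symm
  case rBack => exact congrArg (newBack (mir x)) (neg_neg m).symm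
  case rPulse => exact congrArg (newPulse (mir x)) (neg_neg m).symm
  case lLethal => exact hL newLethal
  case lHarmless => exact hL newHarmless
  case lBack => exact hL newBack
  case lPulse => exact hL newPulse
  all_goals exact congrArg (fun p => x (-m) _ ∧ x (-m) .core ∧ p) h

/-! ### The emission at the seeds -/

def IsSeed (x : Cfg) (m : ℤ) : Prop := x m .seed

/-- The cells that become core cells at the emission and the core cells grown from them in `t`
steps. -/
def Domain (J : ℤ → Prop) (t m : ℤ) : Prop :=
  ∃ i j, J i ∧ J j ∧ j - i ≤ 44 ∧ i - 10 - t ≤ m ∧ m ≤ j + 10 + t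

/-- A seed without another seed close to its right. -/
def Exposed (J : ℤ → Prop) (i : ℤ) : Prop := J i ∧ ¬ Within J (i + 1) (i + 44)

def negSet (J : ℤ → Prop) : ℤ → Prop := fun m => J (-m)

def NearSeed (J : ℤ → Prop) (m : ℤ) : Prop := Within J (m - 120) (m + 120)

/-- Seeds at distance at most 44 = 2 · 22 share one core and send no fronts towards each other,
since these would start already crossed. All remnants near a seed are erased. Seeds vanish, so only
those of the initial configuration ever count. -/
def emit (x : Cfg) : Cfg := fun m f =>
  match f with
  | .core => Domain (IsSeed x) 0 m ∨ (¬ NearSeed (IsSeed x) m ∧ x m .core)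
  | .solid => Within (IsSeed x) (m - 1) m ∨ (¬ NearSeed (IsSeed x) m ∧ x m .solid)
  | .sigR => (IsSeed x (m - 2) ∧ ¬ Within (IsSeed x) (m - 1) m) ∨
      (¬ NearSeed (IsSeed x) m ∧ x m .sigR)
  | .mark => (IsSeed x (m - 4) ∧ ¬ Within (IsSeed x) (m - 3) m) ∨
      (¬ NearSeed (IsSeed x) m ∧ x m .mark)
  | .seed => False
  | .rLethal => Exposed (IsSeed x) (m - 22) ∨ (¬ NearSeed (IsSeed x) m ∧ x m .rLethal)
  | .rBack => Exposed (IsSeed x) (m - 16) ∨ (¬ NearSeed (IsSeed x) m ∧ x m .rBack)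
  | .lLethal => Exposed (negSet (IsSeed x)) (-m - 22) ∨ (¬ NearSeed (IsSeed x) m ∧ x m .lLethal)
  | .lBack => Exposed (negSet (IsSeed x)) (-m - 16) ∨ (¬ NearSeed (IsSeed x) m ∧ x m .lBack)
  | f => ¬ NearSeed (IsSeed x) m ∧ x m f

/-! ### The inner automaton -/

def newSolid (x : Cfg) (m : ℤ) : Prop := x m .solid ∨ (x m .sigL ∧ x (m - 1) .solid)

def inner (x : Cfg) : Cfg := fun m f =>
  match f with
  | .solid => x m .core ∧ newSolid x m
  | .sigL => x m .core ∧ ¬ newSolid x m ∧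
      (x (m + 1) .sigL ∨ (x m .sigR ∧ (x (m + 1) .mark ∨ x (m + 1) .solid)))
  | .sigR => x m .core ∧ ¬ newSolid x m ∧
      ((x (m - 1) .sigR ∧ ¬ x m .mark) ∨ (x (m - 1) .sigL ∧ x (m - 2) .solid))
  | .mark => x m .core ∧ ¬ newSolid x m ∧
      ((x m .mark ∧ ¬ x (m - 1) .sigR) ∨ (x (m - 2) .mark ∧ x (m - 3) .sigR))
  | f => x m f

/-- The cellular automaton. -/
def parabolaCA (x : Cfg) : Cfg := emit (collide^[14] (inner x))

/-! ### Locality -/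

/-- `Φ x m` depends, uniformly in `m`, only on a bounded neighbourhood of `m` in `x`. -/
def IsLoc {A β : Type*} (Φ : (ℤ → A) → ℤ → β) : Prop :=
  ∃ r : ℤ, ∀ x y m m', (∀ u : ℤ, |u| ≤ r → x (m + u) = y (m' + u)) → Φ x m = Φ y m'

section Locality

variable {A B : Type*} {β γ δ : Type*}

theorem IsLoc.isCellularAutomaton [Nonempty A] {F : (ℤ → A) → (ℤ → A)} (h : IsLoc F) :
    IsCellularAutomaton F := by
  classical
  obtain ⟨r, hr⟩ := h
  refine ⟨-r, r, fun w => F (fun m => if hm : m ∈ Set.Icc (-r) r then w ⟨m, hm⟩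
    else Classical.arbitrary A) 0, fun x m => ?_⟩
  apply hr
  intro u hu
  have hu' : u ∈ Set.Icc (-r) r := abs_le.mp hu
  simp [hu'.1, hu'.2]

theorem IsLoc.id : IsLoc (fun (x : ℤ → A) m => x m) :=
  ⟨0, fun x y m m' h => by simpa using h 0 (by simp)⟩

theorem IsLoc.const (c : β) : IsLoc (fun (_ : ℤ → A) (_ : ℤ) => c) :=
  ⟨0, fun _ _ _ _ _ => rfl⟩

theorem IsLoc.map {Φ : (ℤ → A) → ℤ → β} (h : IsLoc Φ) (g : β → γ) :
    IsLoc (fun x m => g (Φ x m)) := by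
  obtain ⟨r, hr⟩ := h
  exact ⟨r, fun x y m m' e => congrArg g (hr x y m m' e)⟩

theorem IsLoc.map₂ {Φ : (ℤ → A) → ℤ → β} {Ψ : (ℤ → A) → ℤ → γ} (h : IsLoc Φ) (h' : IsLoc Ψ)
    (g : β → γ → δ) : IsLoc (fun x m => g (Φ x m) (Ψ x m)) := by
  obtain ⟨r, hr⟩ := h
  obtain ⟨r', hr'⟩ := h'
  refine ⟨max r r', fun x y m m' e => ?_⟩
  change g _ _ = g _ _
  rw [hr x y m m' fun u hu => e u (hu.trans (le_max_left _ _)),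
    hr' x y m m' fun u hu => e u (hu.trans (le_max_right _ _))]

theorem IsLoc.shift {Φ : (ℤ → A) → ℤ → β} (h : IsLoc Φ) (c : ℤ) :
    IsLoc (fun x m => Φ x (m + c)) := by
  obtain ⟨r, hr⟩ := h
  refine ⟨r + |c|, fun x y m m' e => hr _ _ _ _ fun u hu => ?_⟩
  rw [add_assoc, add_assoc]
  exact e _ ((abs_add_le c u).trans (by linarith))

theorem IsLoc.shift' {Φ : (ℤ → A) → ℤ → β} (h : IsLoc Φ) (c : ℤ) :
    IsLoc (fun x m => Φ x (m - c)) := h.shift (-c)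

theorem IsLoc.comp {F : (ℤ → A) → (ℤ → B)} {Φ : (ℤ → B) → ℤ → β} (h : IsLoc Φ) (hF : IsLoc F) :
    IsLoc (fun x m => Φ (F x) m) := by
  obtain ⟨r, hr⟩ := h
  obtain ⟨s, hs⟩ := hF
  refine ⟨r + s, fun x y m m' e => hr _ _ _ _ fun u hu => hs _ _ _ _ fun v hv => ?_⟩
  rw [add_assoc, add_assoc]
  exact e _ ((abs_add_le u v).trans (by linarith))

theorem IsLoc.iterate {F : (ℤ → A) → (ℤ → A)} (hF : IsLoc F) (n : ℕ) : IsLoc (F^[n]) := by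
  induction n with
  | zero => exact IsLoc.id
  | succ n ih =>
    have := ih.comp hF
    simpa only [Function.iterate_succ, Function.comp_def] using this

theorem IsLoc.and {Φ Ψ : (ℤ → A) → ℤ → Prop} (h : IsLoc Φ) (h' : IsLoc Ψ) :
    IsLoc (fun x m => Φ x m ∧ Ψ x m) := h.map₂ h' And

theorem IsLoc.or {Φ Ψ : (ℤ → A) → ℤ → Prop} (h : IsLoc Φ) (h' : IsLoc Ψ) :
    IsLoc (fun x m => Φ x m ∨ Ψ x m) := h.map₂ h' Or

theorem IsLoc.not {Φ : (ℤ → A) → ℤ → Prop} (h : IsLoc Φ) :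
    IsLoc (fun x m => ¬ Φ x m) := h.map Not

/-- A local predicate in a window, possibly restricted by a relation to the centre. -/
theorem IsLoc.exists_le {Φ : (ℤ → A) → ℤ → Prop} (h : IsLoc Φ) (a b : ℤ) :
    IsLoc (fun x m => Within (Φ x) (m + a) (m + b)) := by
  obtain ⟨r, hr⟩ := h
  have key : ∀ x y m m', (∀ u : ℤ, |u| ≤ r + |a| + |b| → x (m + u) = y (m' + u)) →
      Within (Φ x) (m + a) (m + b) → Within (Φ y) (m' + a) (m' + b) := by
    rintro x y m m' e ⟨q, h1, h2, h3⟩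
    refine ⟨m' + (q - m), by linarith, by linarith, ?_⟩
    rw [← hr x y q _ fun u hu => ?_]
    · exact h3
    · rw [add_assoc, show q + u = m + ((q - m) + u) by ring]
      refine e _ ((abs_add_le _ _).trans ?_)
      have : |q - m| ≤ |a| + |b| := by
        rw [abs_le]
        constructor
        · linarith [neg_abs_le a, abs_nonneg b]
        · linarith [le_abs_self b, abs_nonneg a]
      linarith
  refine ⟨r + |a| + |b|, fun x y m m' e => propext ⟨key x y m m' e, key y x m' m fun u hu => ?_⟩⟩
  exact (e u hu).symm

theorem IsLoc.within {Φ : (ℤ → A) → ℤ → Prop} (h : IsLoc Φ) (a b : ℤ) :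
    IsLoc (fun x m => Within (Φ x) (m - a) (m + b)) := h.exists_le (-a) b

theorem IsLoc.within₀ {Φ : (ℤ → A) → ℤ → Prop} (h : IsLoc Φ) (b : ℤ) :
    IsLoc (fun x m => Within (Φ x) m (m + b)) := by simpa using h.exists_le 0 b

theorem IsLoc.within₁ {Φ : (ℤ → A) → ℤ → Prop} (h : IsLoc Φ) (a : ℤ) :
    IsLoc (fun x m => Within (Φ x) (m - a) m) := by simpa using h.within a 0

theorem isLoc_fld (f : Fld) : IsLoc (fun (x : Cfg) m => x m f) :=
  IsLoc.id.map fun c : Cell => c f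

theorem IsLoc.mir {Φ : Cfg → ℤ → β} (h : IsLoc Φ) :
    IsLoc (fun (x : Cfg) m => Φ (mir x) (-m)) := by
  obtain ⟨r, hr⟩ := h
  refine ⟨r, fun x y m m' e => hr _ _ _ _ fun u hu => ?_⟩
  funext f
  have := e (-u) (by simpa using hu)
  simp only [ParabolaCA.mir, neg_add, neg_neg, this]

theorem isLoc_rFront : IsLoc rFront := (isLoc_fld _).or (isLoc_fld _)

theorem isLoc_lFront : IsLoc lFront := (isLoc_fld _).or (isLoc_fld _)

theorem isLoc_lethal : IsLoc lethal := (isLoc_fld _).or (isLoc_fld _)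

theorem isLoc_surv : IsLoc surv :=
  (isLoc_fld _).or ((isLoc_fld _).and ((isLoc_fld .core).within₀ 4).not)

theorem isLoc_cross : IsLoc cross := isLoc_surv.mir.exists_le 1 6

theorem isLoc_hot : IsLoc hot := (isLoc_fld _).or ((isLoc_fld .rPulse).within₁ 4)

theorem isLoc_newCore : IsLoc newCore :=
  ((isLoc_fld .core).within 1 1).and (isLoc_lethal.within 8 8).not

theorem isLoc_newLethal : IsLoc newLethal :=
  (isLoc_surv.shift' 3).and ((isLoc_hot.shift' 3).and (isLoc_cross.shift' 3).not)

theorem isLoc_newHarmless : IsLoc newHarmless :=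
  (isLoc_surv.shift' 3).and ((isLoc_cross.shift' 3).or (isLoc_hot.shift' 3).not)

theorem isLoc_newBack : IsLoc newBack :=
  ((isLoc_fld .rBack).shift' 2).and
    ((isLoc_rFront.shift' 3).not.and ((isLoc_fld .core).within 2 1).not)

theorem isLoc_newPulse : IsLoc newPulse :=
  (((isLoc_fld .rPulse).shift' 7).and
    (((isLoc_fld .core).within 7 1).not.and (isLoc_lFront.within 6 7).not)).or
    (isLoc_newBack.and (isLoc_lFront.within 1 3))

/-- A map between configurations is local if each of its finitely many components is. -/
theorem IsLoc.of_fld {G : Cfg → Cfg} (h : ∀ f, IsLoc (fun x m => G x m f)) : IsLoc G := by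
  choose r hr using h
  refine ⟨∑ f, |r f|, fun x y m m' e => ?_⟩
  funext f
  refine hr f x y m m' fun u hu => e u (hu.trans ((le_abs_self _).trans ?_))
  exact Finset.single_le_sum (f := fun f => |r f|) (fun i _ => abs_nonneg _) (Finset.mem_univ f)

theorem isLoc_collide : IsLoc collide := by
  apply IsLoc.of_fld
  intro f
  cases f
  case core => exact isLoc_newCore
  case seed => exact isLoc_fld _
  case rLethal => exact isLoc_newLethal
  case rHarmless => exact isLoc_newHarmless
  case rBack => exact isLoc_newBack
  case rPulse => exact isLoc_newPulse
  case lLethal => exact isLoc_newLethal.mir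
  case lHarmless => exact isLoc_newHarmless.mir
  case lBack => exact isLoc_newBack.mir
  case lPulse => exact isLoc_newPulse.mir
  all_goals exact (isLoc_fld _).and ((isLoc_fld _).and isLoc_newCore)

theorem isLoc_inner : IsLoc inner := by
  have hs : IsLoc newSolid :=
    (isLoc_fld _).or ((isLoc_fld _).and ((isLoc_fld .solid).shift' 1))
  apply IsLoc.of_fld
  intro f
  cases f
  case solid => exact (isLoc_fld _).and hs
  case sigL =>
    exact (isLoc_fld _).and (hs.not.and (((isLoc_fld .sigL).shift 1).or
      ((isLoc_fld _).and (((isLoc_fld .mark).shift 1).or ((isLoc_fld .solid).shift 1)))))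
  case sigR =>
    exact (isLoc_fld _).and (hs.not.and ((((isLoc_fld .sigR).shift' 1).and (isLoc_fld _).not).or
      (((isLoc_fld .sigL).shift' 1).and ((isLoc_fld .solid).shift' 2))))
  case mark =>
    exact (isLoc_fld _).and (hs.not.and (((isLoc_fld _).and ((isLoc_fld .sigR).shift' 1).not).or
      (((isLoc_fld .mark).shift' 2).and ((isLoc_fld .sigR).shift' 3))))
  all_goals exact isLoc_fld _

theorem isLoc_domain : IsLoc (fun x m => Domain (IsSeed x) 0 m) := by
  have key : ∀ (x y : Cfg) (m m' : ℤ), (∀ u : ℤ, |u| ≤ 54 → x (m + u) = y (m' + u)) →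
      Domain (IsSeed x) 0 m → Domain (IsSeed y) 0 m' := by
    rintro x y m m' e ⟨i, j, hi, hj, h1, h2, h3⟩
    have hi' := e (i - m) (by rw [abs_le]; constructor <;> omega)
    have hj' := e (j - m) (by rw [abs_le]; constructor <;> omega)
    refine ⟨m' + (i - m), m' + (j - m), ?_, ?_, by omega, by omega, by omega⟩
    · unfold IsSeed at *
      rw [← hi']
      simpa using hi
    · unfold IsSeed at *
      rw [← hj']
      simpa using hj
  exact ⟨54, fun x y m m' e => propext ⟨key x y m m' e, key y x m' m fun u hu => (e u hu).symm⟩⟩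

theorem isLoc_emit : IsLoc emit := by
  have hs : IsLoc IsSeed := isLoc_fld _
  have hn : IsLoc (fun x m => ¬ NearSeed (IsSeed x) m) := (hs.within 120 120).not
  have hE : IsLoc (fun x m => Exposed (IsSeed x) m) := hs.and (hs.exists_le 1 44).not
  have hE' : ∀ c, IsLoc (fun x m => Exposed (negSet (IsSeed x)) (-m - c)) := fun c =>
    (hE.shift' c).mir
  apply IsLoc.of_fld
  intro f
  cases f
  case core => exact isLoc_domain.or (hn.and (isLoc_fld _))
  case solid => exact (hs.within₁ 1).or (hn.and (isLoc_fld _))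
  case sigR => exact ((hs.shift' 2).and (hs.within₁ 1).not).or (hn.and (isLoc_fld _))
  case mark => exact ((hs.shift' 4).and (hs.within₁ 3).not).or (hn.and (isLoc_fld _))
  case seed => exact IsLoc.const False
  case rLethal => exact (hE.shift' 22).or (hn.and (isLoc_fld _))
  case rBack => exact (hE.shift' 16).or (hn.and (isLoc_fld _))
  case lLethal => exact (hE' 22).or (hn.and (isLoc_fld _))
  case lBack => exact (hE' 16).or (hn.and (isLoc_fld _))
  all_goals exact hn.and (isLoc_fld _)

theorem isLoc_parabolaCA : IsLoc parabolaCA :=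
  isLoc_emit.comp ((isLoc_collide.iterate 14).comp isLoc_inner)

end Locality

/-! ### Geometry of the seeds -/

/-- The site `q` lies in the gap to the right of the domain of the seed `i` at time `t`. -/
def Gap (J : ℤ → Prop) (t i q : ℤ) : Prop := i + 10 + t < q ∧ ∀ j, J j → i < j → q < j - 10 - t

/-- The front of the seed `i` has not yet met the front of a seed on its right. -/
def Before (J : ℤ → Prop) (t i : ℤ) : Prop :=
  ∀ j, J j → i < j → i + 22 + 3 * t < j - 22 - 3 * t

/-- Such cores are remnants of the initial configuration. -/
def FakeCore (J : ℤ → Prop) (t : ℤ) (x : Cfg) (q : ℤ) : Prop := x q .core ∧ ¬ Domain J t q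

theorem domain_of_seed {J : ℤ → Prop} {t j m : ℤ} (hj : J j) (h1 : j - 10 - t ≤ m)
    (h2 : m ≤ j + 10 + t) : Domain J t m := ⟨j, j, hj, hj, by omega, h1, h2⟩

theorem domain_mono {J : ℤ → Prop} {t m : ℤ} (h : Domain J t m) : Domain J (t + 1) m := by
  obtain ⟨i, j, hi, hj, h1, h2, h3⟩ := h
  exact ⟨i, j, hi, hj, h1, by omega, by omega⟩

theorem domain_negSet (J : ℤ → Prop) (t m : ℤ) : Domain (negSet J) t (-m) ↔ Domain J t m := by
  constructor
  · rintro ⟨i, j, hi, hj, h1, h2, h3⟩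
    exact ⟨-j, -i, hj, hi, by omega, by omega, by omega⟩
  · rintro ⟨i, j, hi, hj, h1, h2, h3⟩
    exact ⟨-j, -i, by simpa [negSet] using hj, by simpa [negSet] using hi, by omega, by omega,
      by omega⟩

theorem negSet_negSet (J : ℤ → Prop) : negSet (negSet J) = J := by
  funext m
  simp [negSet]

theorem exposed_lt {J : ℤ → Prop} {i j : ℤ} (h : Exposed J i) (hj : J j) (hij : i < j) :
    i + 44 < j := by
  by_contra hc
  exact h.2 ⟨j, by omega, by omega, hj⟩

theorem Gap.not_domain {J : ℤ → Prop} {t i q : ℤ} (hi : Exposed J i)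
    (h : Gap J t i q) : ¬ Domain J t q := by
  rintro ⟨a, b, ha, hb, h1, h2, h3⟩
  obtain ⟨h4, h5⟩ := h
  rcases lt_or_ge i b with hb' | hb'
  · have := exposed_lt hi hb hb'
    have := h5 a ha (by omega)
    omega
  · omega

/-- The seed `i` is the last one whose own domain ends before `q`. A seed within 44 to its right
would put `q` into their common domain, so `i` is exposed. -/
theorem exists_gap {J : ℤ → Prop} {t u q : ℤ} (ht : 0 ≤ t) (hu : Domain J t u) (hq : ¬ Domain J t q)
    (h : u < q) : ∃ i, Exposed J i ∧ Gap J t i q ∧ u ≤ i + 10 + t := by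
  obtain ⟨a, b, ha, hb, h1, h2, h3⟩ := hu
  have hbq : b + 10 + t < q := by
    by_contra hc
    exact hq ⟨a, b, ha, hb, h1, by omega, by omega⟩
  obtain ⟨i, ⟨hi, hiq⟩, hmax⟩ := Int.exists_greatest_of_bdd
    (P := fun j => J j ∧ j + 10 + t < q) ⟨q - 10 - t, fun z hz => by omega⟩ ⟨b, hb, hbq⟩
  have hbi := hmax b ⟨hb, hbq⟩
  have hgap : ∀ j, J j → i < j → q < j - 10 - t := by
    intro j hj hij
    by_contra hc
    have : ¬ (j + 10 + t < q) := fun hj' => by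
      have := hmax j ⟨hj, hj'⟩
      omega
    exact hq (domain_of_seed hj (by omega) (by omega))
  refine ⟨i, ⟨hi, ?_⟩, ⟨hiq, hgap⟩, by omega⟩
  rintro ⟨j, h4, h5, hj⟩
  have := hgap j hj (by omega)
  exact hq ⟨i, j, hi, hj, by omega, by omega, by omega⟩

/-- If the front of `i` has met the front of a seed on its right, it has met that of the next. -/
theorem exists_next {J : ℤ → Prop} {t i : ℤ} (hi : Exposed J i) (h : ¬ Before J t i) :
    ∃ j, J j ∧ i < j ∧ Exposed (negSet J) (-j) ∧ j - 22 - 3 * t ≤ i + 22 + 3 * t ∧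
      ∀ k, J k → k < j → k ≤ i := by
  unfold Before at h
  push Not at h
  obtain ⟨a, ha, hia, h1⟩ := h
  obtain ⟨j, ⟨hj, hij⟩, hmin⟩ := Int.exists_least_of_bdd
    (P := fun j => J j ∧ i < j) ⟨i, fun z hz => by omega⟩ ⟨a, ha, hia⟩
  have hja := hmin a ⟨ha, hia⟩
  have hk : ∀ k, J k → k < j → k ≤ i := by
    intro k hk hkj
    by_contra hc
    have := hmin k ⟨hk, by omega⟩
    omega
  refine ⟨j, hj, hij, ⟨by simpa [negSet] using hj, ?_⟩, by omega, hk⟩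
  rintro ⟨k, h2, h3, h4⟩
  have h5 := hk (-k) h4 (by omega)
  have h6 := exposed_lt hi hj hij
  omega

/-! ### The left-hand rules -/

theorem lFront_iff (x : Cfg) (m : ℤ) : rFront (mir x) (-m) ↔ lFront x m := by
  simp [rFront, lFront, mir, Fld.swap]

theorem lFront_mir (x : Cfg) : lFront (mir x) = fun m => rFront x (-m) := by
  funext m
  simp [rFront, lFront, mir, Fld.swap]

theorem surv_mir (x : Cfg) (z : ℤ) : surv (mir x) (-z) ↔
    x z .lLethal ∨ (x z .lHarmless ∧ ¬ Within (fun q => x q .core) (z - 4) z) := by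
  have h := within_neg (fun q => x q .core) (-z) (-z + 4)
  rw [neg_neg, show -(-z + 4) = z - 4 by ring] at h
  simp only [surv, mir, Fld.swap, neg_neg, h]

theorem cross_mir (x : Cfg) (z : ℤ) : cross (mir x) (-z) ↔ Within (surv x) (z - 6) (z - 1) := by
  have h := within_neg (surv x) (-z + 1) (-z + 6)
  rw [show -(-z + 6) = z - 6 by ring, show -(-z + 1) = z - 1 by ring] at h
  simp only [cross, mir_mir, h]

theorem hot_mir (x : Cfg) (z : ℤ) : hot (mir x) (-z) ↔
    x z .lLethal ∨ Within (fun u => x u .lPulse) z (z + 4) := by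
  have h := within_neg (fun q => x q .lPulse) (-z - 4) (-z)
  rw [neg_neg, show -(-z - 4) = z + 4 by ring] at h
  simp only [hot, mir, Fld.swap, neg_neg, h]

theorem newPulse_mir (x : Cfg) (m : ℤ) : newPulse (mir x) (-m) ↔
    (x (m + 7) .lPulse ∧ ¬ Within (fun q => x q .core) (m - 1) (m + 7) ∧
      ¬ Within (rFront x) (m - 7) (m + 6)) ∨
    (newBack (mir x) (-m) ∧ Within (rFront x) (m - 3) (m + 1)) := by
  have h1 := within_neg (fun q => x q .core) (-m - 7) (-m + 1)
  have h2 := within_neg (rFront x) (-m - 6) (-m + 7)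
  have h3 := within_neg (rFront x) (-m - 1) (-m + 3)
  rw [show -(-m + 1) = m - 1 by ring, show -(-m - 7) = m + 7 by ring] at h1
  rw [show -(-m + 7) = m - 7 by ring, show -(-m - 6) = m + 6 by ring] at h2
  rw [show -(-m + 3) = m - 3 by ring, show -(-m - 1) = m + 1 by ring] at h3
  rw [newPulse, lFront_mir, h2, h3]
  simp only [mir, Fld.swap, h1]
  rw [show -(-m - 7) = m + 7 by ring]

theorem rFront_collide (x : Cfg) (m : ℤ) : rFront (collide x) m ↔ surv x (m - 3) := by
  change newLethal x m ∨ newHarmless x m ↔ _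
  unfold newLethal newHarmless
  grind

theorem lFront_collide (x : Cfg) (m : ℤ) :
    lFront (collide x) m ↔ surv (mir x) (-(m + 3)) := by
  rw [← lFront_iff, ← collide_mir, rFront_collide, show -m - 3 = -(m + 3) by ring]

theorem surv.rFront {x : Cfg} {y : ℤ} (h : surv x y) : rFront x y := by
  rcases h with h | h
  · exact Or.inl h
  · exact Or.inr h.1

theorem surv.lFront {x : Cfg} {z : ℤ} (h : surv (mir x) (-z)) : lFront x z :=
  (lFront_iff x z).1 h.rFront

/-! ### The invariant -/

/-- The front of the seed `i` is lethal or will become so before it reaches a foreign core. -/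
def Ready (J : ℤ → Prop) (t : ℤ) (x : Cfg) (i : ℤ) : Prop :=
  x (i + 22 + 3 * t) .rLethal ∨
  (∃ z, lFront x z ∧ i + 16 + 2 * t < z ∧ z ≤ i + 22 + 3 * t) ∨
  -- A pulse is on its way and no opposing front is left between it and the front. The lead of the
  -- pulse, (distance front to core) - (distance pulse to front), never decreases, as the second
  -- term shrinks by 4 per step and the first by at most 4.
  (∃ u, x u .rPulse ∧ i + 16 + 2 * t ≤ u ∧ u ≤ i + 22 + 3 * t ∧
    (∀ z, lFront x z → u < z → i + 22 + 3 * t < z) ∧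
    ∀ q, FakeCore J t x q → i + 22 + 3 * t < q → 13 ≤ q - 2 * (i + 22 + 3 * t) + u) ∨
  (∃ y, lFront x y ∧ i + 22 + 3 * t < y ∧ y ≤ i + 22 + 3 * t + 6 ∧
    ∀ q, FakeCore J t x q → i + 22 + 3 * t < q → 14 ≤ q - (i + 22 + 3 * t))

/-- The invariant of the collisions, as far as it concerns the right-hand sides of the seeds. -/
structure Half (J : ℤ → Prop) (t : ℤ) (x : Cfg) : Prop where
  back_le : ∀ y z, rFront x y → x z .rBack → z ≤ y → t + 6 ≤ y - z
  core_le : ∀ y q, rFront x y → FakeCore J t x q → q < y → 2 * t + 29 ≤ y - q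
  front_core : ∀ m, rFront x m → ¬ x m .core
  pulse_core : ∀ m, x m .rPulse → ¬ x m .core
  back_core : ∀ m, x m .rBack → ¬ x m .core
  gap_core : ∀ i, Exposed J i → ∀ q, Gap J t i q → x q .core → i + 22 + 3 * t < q
  gap_front : ∀ i, Exposed J i → ∀ y, Gap J t i y → rFront x y → i + 22 + 3 * t ≤ y
  gap_lethal : ∀ i, Exposed J i → ∀ z, Gap J t i z → x z .lLethal → i + 22 + 3 * t < z
  -- An intruding front is at least as close to the core of `i` as to the pulse that chases it; both
  -- distances close at speed 4, so it dies before it can turn lethal.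
  gap_pulse : ∀ i, Exposed J i → ∀ u z, Gap J t i u → Gap J t i z → x u .lPulse → lFront x z →
    z ≤ u → u ≤ i + 22 + 3 * t → 2 * z ≤ u + (i + 10 + t)
  far_pulse : ∀ i, Exposed J i → ∀ u z, Gap J t i u → Gap J t i z → x u .lPulse → lFront x z →
    z ≤ i + 22 + 3 * t → i + 22 + 3 * t < u → z + 4 < u
  front : ∀ i, Exposed J i → (∀ j, J j → i < j → i + 22 + 3 * t < j - 10 - t) →
    rFront x (i + 22 + 3 * t)
  back : ∀ i, Exposed J i → Before J t i → x (i + 16 + 2 * t) .rBack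
  ready : ∀ i, Exposed J i → Before J t i → Ready J t x i

/-- The invariant of the collisions. -/
structure Inv (J : ℤ → Prop) (t : ℤ) (x : Cfg) : Prop where
  nonneg : 0 ≤ t
  right : Half J t x
  left : Half (negSet J) t (mir x)
  core : ∀ m, Domain J t m → x m .core

/-! ### Consequences of the invariant, and its preservation by a collision step -/

namespace Inv

variable {J : ℤ → Prop} {t : ℤ} {x : Cfg}

theorem mir (h : Inv J t x) : Inv (negSet J) t (mir x) where
  nonneg := h.nonneg
  right := h.left
  left := by
    rw [negSet_negSet, mir_mir]
    exact h.right
  core m hm := by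
    have := h.core (-m) ((domain_negSet J t (-m)).1 (by simpa using hm))
    exact this

theorem fakeCore_mir (q : ℤ) : FakeCore (negSet J) t (ParabolaCA.mir x) (-q) ↔ FakeCore J t x q := by
  simp [FakeCore, ParabolaCA.mir, Fld.swap, domain_negSet]

theorem left_core_le (h : Inv J t x) {z q : ℤ} (hz : lFront x z) (hq : FakeCore J t x q)
    (hzq : z < q) : 2 * t + 29 ≤ q - z := by
  have := h.left.core_le (-z) (-q) ((lFront_iff x z).2 hz) ((fakeCore_mir q).2 hq) (by omega)
  omega

theorem left_front_core (h : Inv J t x) {m : ℤ} (hm : lFront x m) : ¬ x m .core := by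
  have := h.left.front_core (-m) ((lFront_iff x m).2 hm)
  simpa [ParabolaCA.mir, Fld.swap] using this

theorem left_pulse_core (h : Inv J t x) {m : ℤ} (hm : x m .lPulse) : ¬ x m .core := by
  have := h.left.pulse_core (-m) (by simpa [ParabolaCA.mir, Fld.swap] using hm)
  simpa [ParabolaCA.mir, Fld.swap] using this

/-- In the gap between `i` and the next seed `j`, after the fronts have met, no core lies to the
right of the front of `i`. -/
theorem no_core_after (h : Inv J t x) {i q : ℤ} (hi : Exposed J i) (hb : ¬ Before J t i)
    (hq : Gap J t i q) (hc : x q .core) : False := by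
  obtain ⟨j, hj, hij, hje, hle, hk⟩ := exists_next hi hb
  have h1 := h.right.gap_core i hi q hq hc
  have h2 := h.left.gap_core (-j) hje (-q) ⟨by have := hq.2 j hj hij; omega, fun k hk1 hk2 => by
    have h3 := hk (-k) hk1 (by omega)
    have := hq.1
    omega⟩ (by simpa [ParabolaCA.mir, Fld.swap] using hc)
  omega

theorem no_front_after (h : Inv J t x) {i z : ℤ} (hi : Exposed J i) (hb : ¬ Before J t i)
    (hz : Gap J t i z) (hc : lFront x z) : z ≤ i + 22 + 3 * t := by
  obtain ⟨j, hj, hij, hje, hle, hk⟩ := exists_next hi hb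
  have h2 := h.left.gap_front (-j) hje (-z) ⟨by have := hz.2 j hj hij; omega, fun k hk1 hk2 => by
    have h3 := hk (-k) hk1 (by omega)
    have := hz.1
    omega⟩ ((lFront_iff x z).2 hc)
  omega

/-- While the front of a seed is harmless, each alternative of `Ready` keeps foreign cores away, so
the front cannot die at one. -/
theorem fake_far (h : Inv J t x) {i : ℤ} (hi : Exposed J i) (hb : Before J t i)
    (hl : ¬ x (i + 22 + 3 * t) .rLethal) {q : ℤ} (hq : FakeCore J t x q)
    (hlt : i + 22 + 3 * t < q) : 13 ≤ q - (i + 22 + 3 * t) := by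
  have ht := h.nonneg
  rcases h.right.ready i hi hb with h1 | ⟨z, hz, h1, h2⟩ | ⟨u, hu, h1, h2, h3, h4⟩ | ⟨y, hy, h1, h2, h3⟩
  · exact absurd h1 hl
  · have := h.left_core_le hz hq (by omega)
    omega
  · have := h4 q hq hlt
    omega
  · have := h3 q hq hlt
    omega

theorem surv (h : Inv J t x) {i : ℤ} (hi : Exposed J i)
    (hlt : ∀ j, J j → i < j → i + 22 + 3 * t + 4 < j - 10 - t) : surv x (i + 22 + 3 * t) := by
  have ht := h.nonneg
  have hF := h.right.front i hi fun j hj hij => by have := hlt j hj hij; omega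
  by_cases hl : x (i + 22 + 3 * t) .rLethal
  · exact Or.inl hl
  refine Or.inr ⟨hF.resolve_left hl, ?_⟩
  rintro ⟨q, h1, h2, hq⟩
  have hg : Gap J t i q := ⟨by omega, fun j hj hij => by have := hlt j hj hij; omega⟩
  have h3 := h.right.gap_core i hi q hg hq
  by_cases hb : Before J t i
  · have := h.fake_far hi hb hl ⟨hq, hg.not_domain hi⟩ h3
    omega
  · exact h.no_core_after hi hb hg hq

theorem surv_of_before (h : Inv J t x) {i : ℤ} (hi : Exposed J i) (hb : Before J t i) :
    ParabolaCA.surv x (i + 22 + 3 * t) := by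
  have ht := h.nonneg
  exact h.surv hi fun j hj hij => by have := hb j hj hij; omega

/-- A site without core that is close to the gap of the next step lies in the gap. -/
theorem gap (h : Inv J t x) {i m m' : ℤ} (hi : Exposed J i) (hm : ¬ x m .core)
    (hg : Gap J (t + 1) i m') (h1 : m' - 10 ≤ m) (h2 : m ≤ m' + 10) : Gap J t i m := by
  have ht := h.nonneg
  obtain ⟨h3, h4⟩ := hg
  constructor
  · by_contra hc
    exact hm (h.core m (domain_of_seed hi.1 (by omega) (by omega)))
  · intro j hj hij
    have := h4 j hj hij
    by_contra hc
    exact hm (h.core m (domain_of_seed hj (by omega) (by omega)))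

theorem not_lethal_near (h : Inv J t x) {m y : ℤ} (hm : Domain J t m) (hy : lethal x y)
    (h1 : m < y) (h2 : y ≤ m + 9) : False := by
  have ht := h.nonneg
  have hyc : ¬ x y .core := by
    rcases hy with hy | hy
    · exact h.right.front_core y (Or.inl hy)
    · exact h.left_front_core (Or.inl hy)
  obtain ⟨i, hi, hg, hle⟩ := exists_gap ht hm (fun hd => hyc (h.core y hd)) h1
  rcases hy with hy | hy
  · have := h.right.gap_front i hi y hg (Or.inl hy)
    omega
  · have := h.right.gap_lethal i hi y hg hy
    omega

theorem exists_near (h : Inv J t x) {m : ℤ} (hm : Domain J (t + 1) m) :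
    ∃ u, Domain J t u ∧ m - 1 ≤ u ∧ u ≤ m + 1 := by
  obtain ⟨i, j, hi, hj, h1, h2, h3⟩ := hm
  rcases le_or_gt m (i - 10 - t - 1) with h4 | h4
  · rcases le_or_gt m (j + 10 + t - 1) with h5 | h5
    · exact ⟨m + 1, ⟨i, j, hi, hj, h1, by omega, by omega⟩, by omega, by omega⟩
    · have := h.nonneg
      exact ⟨m + 1, domain_of_seed hi (by omega) (by omega), by omega, by omega⟩
  · rcases le_or_gt m (j + 10 + t) with h5 | h5
    · exact ⟨m, ⟨i, j, hi, hj, h1, by omega, by omega⟩, by omega, by omega⟩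
    · have := h.nonneg
      exact ⟨m - 1, domain_of_seed hj (by omega) (by omega), by omega, by omega⟩

theorem domain_core_step (h : Inv J t x) {m : ℤ} (hm : Domain J (t + 1) m) : newCore x m := by
  obtain ⟨u, hu, h1, h2⟩ := h.exists_near hm
  refine ⟨⟨u, h1, h2, h.core u hu⟩, ?_⟩
  rintro ⟨y, h3, h4, hy⟩
  rcases lt_trichotomy u y with h5 | h5 | h5
  · exact h.not_lethal_near hu hy h5 (by omega)
  · subst h5
    rcases hy with hy | hy
    · exact h.right.front_core u (Or.inl hy) (h.core u hu)
    · exact h.left_front_core (Or.inl hy) (h.core u hu)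
  · refine h.mir.not_lethal_near (m := -u) (y := -y) ((domain_negSet J t u).2 hu) ?_ (by omega)
      (by omega)
    simpa [lethal, ParabolaCA.mir, Fld.swap, or_comm] using hy

theorem fakeCore_of_step {q : ℤ} (hq : FakeCore J (t + 1) (collide x) q) :
    ∃ p, FakeCore J t x p ∧ q - 1 ≤ p ∧ p ≤ q + 1 := by
  obtain ⟨⟨⟨p, h1, h2, hp⟩, -⟩, hd⟩ := hq
  refine ⟨p, ⟨hp, fun hd' => hd ?_⟩, h1, h2⟩
  obtain ⟨i, j, hi, hj, h3, h4, h5⟩ := hd'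
  exact ⟨i, j, hi, hj, h3, by omega, by omega⟩

/-- The front outruns the core by 3 - 1 = 2 sites. A core that the front would jump over either is
erased, if the front is lethal, or kills it. -/
theorem core_le_step (h : Inv J t x) (y q : ℤ) (hy : rFront (collide x) y)
    (hq : FakeCore J (t + 1) (collide x) q) (hqy : q < y) : 2 * (t + 1) + 29 ≤ y - q := by
  obtain ⟨p, hp, h1, h2⟩ := fakeCore_of_step hq
  have hs := (rFront_collide x y).1 hy
  rcases lt_or_ge p (y - 3) with h3 | h3
  · have := h.right.core_le _ p hs.rFront hp h3
    omega
  · exfalso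
    rcases hs with hs | ⟨hs, hb⟩
    · exact hq.1.2 ⟨y - 3, by omega, by omega, Or.inl hs⟩
    · exact hb ⟨p, by omega, by omega, hp.1⟩

theorem front_core_step (m : ℤ) (hm : rFront (collide x) m) : ¬ (collide x) m .core := by
  rintro ⟨⟨p, h1, h2, hp⟩, hl⟩
  rcases (rFront_collide x m).1 hm with hs | ⟨hs, hb⟩
  · exact hl ⟨m - 3, by omega, by omega, Or.inl hs⟩
  · exact hb ⟨p, by omega, by omega, hp⟩

theorem pulse_core_step (m : ℤ) (hm : (collide x) m .rPulse) : ¬ (collide x) m .core := by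
  rintro ⟨⟨p, h1, h2, hp⟩, -⟩
  rcases hm with ⟨-, hm, -⟩ | ⟨⟨-, -, hm⟩, -⟩
  · exact hm ⟨p, by omega, by omega, hp⟩
  · exact hm ⟨p, by omega, by omega, hp⟩

theorem back_core_step (m : ℤ) (hm : (collide x) m .rBack) : ¬ (collide x) m .core := by
  rintro ⟨⟨p, h1, h2, hp⟩, -⟩
  exact hm.2.2 ⟨p, by omega, by omega, hp⟩

theorem back_le_step (h : Half J t x) (y z : ℤ) (hy : rFront (collide x) y)
    (hz : (collide x) z .rBack) (hzy : z ≤ y) : t + 1 + 6 ≤ y - z := by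
  have hs := ((rFront_collide x y).1 hy).rFront
  obtain ⟨h1, h2, -⟩ := hz
  rcases le_or_gt (z - 2) (y - 3) with h3 | h3
  · have := h.back_le _ _ hs h1 h3
    omega
  · exfalso
    have : z = y := by omega
    subst this
    exact h2 hs

theorem gap_core_step (h : Inv J t x) (i : ℤ) (hi : Exposed J i) (q : ℤ)
    (hg : Gap J (t + 1) i q) (hq : (collide x) q .core) : i + 22 + 3 * (t + 1) < q := by
  have ht := h.nonneg
  obtain ⟨⟨p, h1, h2, hp⟩, hl⟩ := hq
  have hgp : Gap J t i p := ⟨by have := hg.1; omega, fun j hj hij => by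
    have := hg.2 j hj hij
    omega⟩
  by_cases hb : Before J t i
  · have h3 := h.right.gap_core i hi p hgp hp
    by_contra hc
    by_cases hL : x (i + 22 + 3 * t) .rLethal
    · exact hl ⟨i + 22 + 3 * t, by omega, by omega, Or.inl hL⟩
    · have := h.fake_far hi hb hL ⟨hp, hgp.not_domain hi⟩ h3
      omega
  · exact (h.no_core_after hi hb hgp hp).elim

theorem gap_front_step (h : Inv J t x) (i : ℤ) (hi : Exposed J i) (y : ℤ)
    (hg : Gap J (t + 1) i y) (hy : rFront (collide x) y) : i + 22 + 3 * (t + 1) ≤ y := by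
  have hs := ((rFront_collide x y).1 hy).rFront
  have := h.right.gap_front i hi _
    (h.gap hi (h.right.front_core _ hs) hg (by omega) (by omega)) hs
  omega

/-- A front entering the gap crosses the front of `i` and leaves the crossing harmless. Once inside
it could be heated only by a pulse within 4 sites: `gap_pulse` then puts the core of `i` within 4
sites too, so it dies, and `far_pulse` rules out pulses still outside. -/
theorem gap_lethal_step (h : Inv J t x) (i : ℤ) (hi : Exposed J i) (z : ℤ)
    (hg : Gap J (t + 1) i z) (hz : (collide x) z .lLethal) : i + 22 + 3 * (t + 1) < z := by
  have ht := h.nonneg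
  have hz' : newLethal (ParabolaCA.mir x) (-z) := hz
  obtain ⟨hs, hh, hc⟩ := hz'
  rw [show -z - 3 = -(z + 3) by ring] at hs hh hc
  rw [hot_mir] at hh
  rw [cross_mir] at hc
  have hF := hs.lFront
  have hgz := h.gap hi (h.left_front_core hF) hg (m := z + 3) (by omega) (by omega)
  by_contra hlt
  rcases le_or_gt (z + 3) (i + 22 + 3 * t) with h1 | h1
  · have hnl : ¬ x (z + 3) .lLethal := fun hl => by
      have := h.right.gap_lethal i hi _ hgz hl
      omega
    obtain ⟨u, h2, h3, hu⟩ := hh.resolve_left hnl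
    have hgu := h.gap hi (h.left_pulse_core hu) hg (by omega) (by omega)
    rcases le_or_gt u (i + 22 + 3 * t) with h4 | h4
    · have h5 := h.right.gap_pulse i hi u _ hgu hgz hu hF h2 h4
      rw [surv_mir] at hs
      refine (hs.resolve_left hnl).2 ⟨i + 10 + t, by omega, ?_,
        h.core _ (domain_of_seed hi.1 (by omega) (by omega))⟩
      have := hgz.1
      omega
    · have := h.right.far_pulse i hi u _ hgu hgz hu hF h1 h4
      omega
  · by_cases hb : Before J t i
    · exact hc ⟨_, by omega, by omega, h.surv_of_before hi hb⟩
    · have := h.no_front_after hi hb hgz hF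
      omega

/-- A pulse running left that reaches the gap left of the front of `i` was there before. -/
theorem pulse_le (h : Inv J t x) {i u : ℤ} (hi : Exposed J i) (hg : Gap J (t + 1) i u)
    (hu : x (u + 7) .lPulse) (hF : ¬ Within (rFront x) (u - 7) (u + 6)) :
    Gap J t i (u + 7) ∧ (u + 7 ≤ i + 22 + 3 * t ∨ i + 22 + 3 * t + 14 < u + 7) := by
  have hgu := h.gap hi (h.left_pulse_core hu) hg (m := u + 7) (by omega) (by omega)
  refine ⟨hgu, ?_⟩
  by_contra hc
  push Not at hc
  refine hF ⟨i + 22 + 3 * t, by omega, by omega, h.right.front i hi fun j hj hij => ?_⟩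
  have := hgu.2 j hj hij
  omega

/-- An old pulse keeps the inequality by the speeds. A new one starts at a back, which by `back_le`
is at least `t + 7` sites behind the front `z`, and this suffices since `u` has not passed the front
of `i`. -/
theorem gap_pulse_step (h : Inv J t x) (i : ℤ) (hi : Exposed J i) (u z : ℤ)
    (hgu : Gap J (t + 1) i u) (hgz : Gap J (t + 1) i z) (hu : (collide x) u .lPulse)
    (hz : lFront (collide x) z) (hzu : z ≤ u) (hux : u ≤ i + 22 + 3 * (t + 1)) :
    2 * z ≤ u + (i + 10 + (t + 1)) := by
  have hF := ((lFront_collide x z).1 hz).lFront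
  have hgz' := h.gap hi (h.left_front_core hF) hgz (m := z + 3) (by omega) (by omega)
  have hu' : newPulse (ParabolaCA.mir x) (-u) := hu
  rw [newPulse_mir] at hu'
  rcases hu' with ⟨hu', -, hf⟩ | ⟨hu', hf⟩
  · obtain ⟨hgu', h1 | h1⟩ := h.pulse_le hi hgu hu' hf
    · have := h.right.gap_pulse i hi _ _ hgu' hgz' hu' hF (by omega) h1
      omega
    · omega
  · have h1 := back_le_step h.left (-z) (-u)
      (by rw [collide_mir]; exact (lFront_iff _ _).2 hz) hu' (by omega)
    omega

theorem far_pulse_step (h : Inv J t x) (i : ℤ) (hi : Exposed J i) (u z : ℤ)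
    (hgu : Gap J (t + 1) i u) (hu : (collide x) u .lPulse)
    (hz : lFront (collide x) z) (hzx : z ≤ i + 22 + 3 * (t + 1))
    (hux : i + 22 + 3 * (t + 1) < u) : z + 4 < u := by
  have ht := h.nonneg
  have hu' : newPulse (ParabolaCA.mir x) (-u) := hu
  rw [newPulse_mir] at hu'
  rcases hu' with ⟨hu', -, hf⟩ | ⟨hu', hf⟩
  · obtain ⟨hgu', h1 | h1⟩ := h.pulse_le hi hgu hu' hf
    -- The pulse would still lie left of the front of `i`. In the next case it is stopped by that
    -- front unless more than 14 sites ahead, which leaves more than 4 sites after the step.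
    · omega
    · omega
  · have h1 := back_le_step h.left (-z) (-u)
      (by rw [collide_mir]; exact (lFront_iff _ _).2 hz) hu' (by omega)
    omega

theorem front_step (h : Inv J t x) (i : ℤ) (hi : Exposed J i)
    (hlt : ∀ j, J j → i < j → i + 22 + 3 * (t + 1) < j - 10 - (t + 1)) :
    rFront (collide x) (i + 22 + 3 * (t + 1)) := by
  rw [rFront_collide, show i + 22 + 3 * (t + 1) - 3 = i + 22 + 3 * t by ring]
  exact h.surv hi fun j hj hij => by have := hlt j hj hij; omega

theorem before_of_step {i : ℤ} (hb : Before J (t + 1) i) : Before J t i := fun j hj hij => by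
  have := hb j hj hij
  omega

theorem gap_of_before (h : Inv J t x) {i q : ℤ} (hb : Before J t i) (h1 : i + 10 + t < q)
    (h2 : q ≤ i + 22 + 3 * t + 10) : Gap J t i q := by
  have ht := h.nonneg
  exact ⟨h1, fun j hj hij => by have := hb j hj hij; omega⟩

theorem back_step (h : Inv J t x) (i : ℤ) (hi : Exposed J i) (hb : Before J t i) :
    newBack x (i + 16 + 2 * (t + 1)) := by
  have ht := h.nonneg
  refine ⟨?_, fun hF => ?_, ?_⟩
  · rw [show i + 16 + 2 * (t + 1) - 2 = i + 16 + 2 * t by ring]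
    exact h.right.back i hi hb
  · have := h.right.gap_front i hi _ (h.gap_of_before hb (by omega) (by omega)) hF
    omega
  · rintro ⟨q, h1, h2, hq⟩
    have := h.right.gap_core i hi q (h.gap_of_before hb (by omega) (by omega)) hq
    omega

/-- The alternatives of `Ready` form a cycle: a front being crossed leaves an intruder between back
and front; the intruder meets the back and creates a pulse; the pulse heats the front, or is stopped
by a further intruder that is about to cross. -/
theorem ready_step (h : Inv J t x) (i : ℤ) (hi : Exposed J i) (hb : Before J t i)
    (core_le : ∀ z q, lFront (collide x) z → FakeCore J (t + 1) (collide x) q → z < q →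
      2 * (t + 1) + 29 ≤ q - z) :
    Ready J (t + 1) (collide x) i := by
  have ht := h.nonneg
  have hs := h.surv_of_before hi hb
  have eX : i + 22 + 3 * (t + 1) - 3 = i + 22 + 3 * t := by ring
  by_cases hcr : cross x (i + 22 + 3 * t)
  · obtain ⟨z, h1, h2, hz⟩ := hcr
    refine Or.inr (Or.inl ⟨z - 3, ?_, by omega, by omega⟩)
    rw [lFront_collide, show z - 3 + 3 = z by ring]
    exact hz
  by_cases hh : hot x (i + 22 + 3 * t)
  · left
    change newLethal x _
    unfold newLethal
    rw [eX]
    exact ⟨hs, hh, hcr⟩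
  have hl : ¬ x (i + 22 + 3 * t) .rLethal := fun hl => hh (Or.inl hl)
  have hnp : ∀ u, x u .rPulse → u ≤ i + 22 + 3 * t → u < i + 22 + 3 * t - 4 := fun u hu h1 => by
    by_contra hc
    exact hh (Or.inr ⟨u, by omega, h1, hu⟩)
  -- a left front right of the front of `i` survives unless a foreign core is close
  have hsv : ∀ y, lFront x y → i + 22 + 3 * t < y → y ≤ i + 22 + 3 * t + 10 →
      (∀ q, FakeCore J t x q → i + 22 + 3 * t < q → y < q) →
      ParabolaCA.surv (ParabolaCA.mir x) (-y) := by
    intro y hy h1 h2 h3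
    rw [surv_mir]
    rcases hy with hy | hy
    · exact Or.inl hy
    · refine Or.inr ⟨hy, ?_⟩
      rintro ⟨q, h4, h5, hq⟩
      have hg := h.gap_of_before hb (q := q) (by omega) (by omega)
      have h6 := h.right.gap_core i hi q hg hq
      have := h3 q ⟨hq, hg.not_domain hi⟩ h6
      omega
  rcases h.right.ready i hi hb with h1 | ⟨z, hz, h1, h2⟩ | ⟨u, hu, h1, h2, h3, h4⟩ |
    ⟨y, hy, h1, h2, h3⟩
  · exact absurd h1 hl
  · have hz' : lFront (collide x) (z - 3) := by
      rw [lFront_collide, show z - 3 + 3 = z by ring, surv_mir]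
      rcases hz with hz | hz
      · exact Or.inl hz
      · refine Or.inr ⟨hz, ?_⟩
        rintro ⟨q, h4, h5, hq⟩
        have := h.right.gap_core i hi q (h.gap_of_before hb (by omega) (by omega)) hq
        omega
    by_cases hex : ∃ v, lFront (collide x) v ∧ i + 16 + 2 * (t + 1) < v ∧
        v ≤ i + 22 + 3 * (t + 1)
    · exact Or.inr (Or.inl hex)
    · push Not at hex
      have h5 : z - 3 ≤ i + 16 + 2 * (t + 1) := by
        by_contra hc
        have := hex _ hz' (by omega)
        omega
      refine Or.inr (Or.inr (Or.inl ⟨i + 16 + 2 * (t + 1), ?_, le_rfl, by omega,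
        fun v hv hlt => hex v hv hlt, fun q hq hlt => ?_⟩))
      -- The last intruder passes the back during this step, so the pulse starts there.
      · exact Or.inr ⟨h.back_step i hi hb, ⟨z, by omega, by omega, hz⟩⟩
      -- The intruder is at most 4 sites beyond the back, and the back `(t + 1) + 6` behind the
      -- front. The required lead 13 thus needs 2 · 6 + 13 + 4 = 29, the constant in `core_le`.
      · have := core_le _ q hz' hq (by omega)
        omega
  · have h5 := hnp u hu h2
    by_cases hfr : Within (lFront x) (u + 1) (u + 14)
    · obtain ⟨y, h6, h7, hy⟩ := hfr
      have h8 := h3 y hy (by omega)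
      have h9 : ParabolaCA.surv (ParabolaCA.mir x) (-y) := hsv y hy h8 (by omega) fun q hq hlt => by
        have := h4 q hq hlt
        omega
      have h10 : i + 22 + 3 * t + 6 < y := by
        by_contra hc
        exact hcr ⟨y, by omega, by omega, h9⟩
      refine Or.inr (Or.inr (Or.inr ⟨y - 3, ?_, by omega, by omega, fun q hq hlt => ?_⟩))
      · rw [lFront_collide, show y - 3 + 3 = y by ring]
        exact h9
      · obtain ⟨p, hp, h11, h12⟩ := fakeCore_of_step hq
        have := h4 p hp (by omega)
        omega
    · refine Or.inr (Or.inr (Or.inl ⟨u + 7, Or.inl ⟨?_, ?_, ?_⟩, by omega, by omega,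
        fun z hz hlt => ?_, fun q hq hlt => ?_⟩))
      · rw [show u + 7 - 7 = u by ring]
        exact hu
      · rintro ⟨q, h6, h7, hq⟩
        have hg := h.gap_of_before hb (q := q) (by omega) (by omega)
        have h8 := h.right.gap_core i hi q hg hq
        have := h4 q ⟨hq, hg.not_domain hi⟩ h8
        omega
      · rintro ⟨y, h6, h7, hy⟩
        exact hfr ⟨y, by omega, by omega, hy⟩
      · have hz' := (lFront_collide x z).1 hz
        by_contra hc
        have h6 := h3 _ hz'.lFront (by omega)
        exact hcr ⟨z + 3, by omega, by omega, hz'⟩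
      · obtain ⟨p, hp, h11, h12⟩ := fakeCore_of_step hq
        have := h4 p hp (by omega)
        omega
  -- Foreign cores are too far to stop the intruder, so it crosses now, which was excluded.
  · exact absurd ⟨y, by omega, h2, hsv y hy h1 (by omega) fun q hq hlt => by
      have := h3 q hq hlt
      omega⟩ hcr

theorem half_step (h : Inv J t x) : Half J (t + 1) (collide x) where
  back_le := back_le_step h.right
  core_le := h.core_le_step
  front_core := front_core_step
  pulse_core := pulse_core_step
  back_core := back_core_step
  gap_core := h.gap_core_step
  gap_front := h.gap_front_step
  gap_lethal := h.gap_lethal_step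
  gap_pulse i hi u z := h.gap_pulse_step i hi u z
  far_pulse i hi u z hgu _ := h.far_pulse_step i hi u z hgu
  front := h.front_step
  back i hi hb := h.back_step i hi (before_of_step hb)
  ready i hi hb := h.ready_step i hi (before_of_step hb) fun z q hz hq hlt => by
    have := h.mir.core_le_step (-z) (-q) (by rw [collide_mir]; exact (lFront_iff _ _).2 hz)
      (by rw [collide_mir]; exact (fakeCore_mir q).2 hq) (by omega)
    omega

theorem step (h : Inv J t x) : Inv J (t + 1) (collide x) where
  nonneg := by have := h.nonneg; omega
  right := h.half_step
  left := by
    rw [← collide_mir]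
    exact h.mir.half_step
  core m hm := h.domain_core_step hm

theorem iterate (h : Inv J t x) (n : ℕ) : Inv J (t + n) (collide^[n] x) := by
  induction n with
  | zero => simpa using h
  | succ n ih =>
    rw [Function.iterate_succ_apply', Nat.cast_succ, ← add_assoc]
    exact ih.step

/-- Foreign cores keep a distance from the domain. -/
theorem fake_distance (h : Inv J t x) {m q : ℤ} (hm : Domain J t m) (hq : FakeCore J t x q)
    (h1 : m < q) : m + 12 < q := by
  have ht := h.nonneg
  obtain ⟨i, hi, hg, hle⟩ := exists_gap ht hm hq.2 h1
  have := h.right.gap_core i hi q hg hq.1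
  omega

theorem fake_distance' (h : Inv J t x) {m q : ℤ} (hm : Domain J t m) (hq : FakeCore J t x q)
    (h1 : q < m) : q + 12 < m := by
  have := h.mir.fake_distance (m := -m) (q := -q) ((domain_negSet J t m).2 hm)
    ((fakeCore_mir q).2 hq) (by omega)
  omega

end Inv

/-! ### The state after the emission -/

/-- What holds for the right fronts of an arbitrary configuration after `t` steps. -/
structure Spread (t : ℤ) (x : Cfg) : Prop where
  back_le : ∀ y z, rFront x y → x z .rBack → z ≤ y → t ≤ y - z
  core_le : ∀ y q, rFront x y → x q .core → q < y → 2 * t + 1 ≤ y - q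

theorem spread_zero (x : Cfg) : Spread 0 x where
  back_le y z _ _ h := by omega
  core_le y q _ _ h := by omega

theorem Spread.step {t : ℤ} {x : Cfg} (h : Spread t x) : Spread (t + 1) (collide x) where
  back_le y z hy hz hzy := by
    have hs := ((rFront_collide x y).1 hy).rFront
    obtain ⟨h1, h2, -⟩ := hz
    rcases le_or_gt (z - 2) (y - 3) with h3 | h3
    · have := h.back_le _ _ hs h1 h3
      omega
    · have : z = y := by omega
      subst this
      exact absurd hs h2
  core_le y q hy hq hqy := by
    obtain ⟨⟨p, h1, h2, hp⟩, hl⟩ := hq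
    have hs := (rFront_collide x y).1 hy
    rcases lt_or_ge p (y - 3) with h3 | h3
    · have := h.core_le _ p hs.rFront hp h3
      omega
    · exfalso
      rcases hs with hs | ⟨hs, hb⟩
      · exact hl ⟨y - 3, by omega, by omega, Or.inl hs⟩
      · exact hb ⟨p, by omega, by omega, hp⟩

theorem spread_iterate (x : Cfg) (n : ℕ) : Spread n (collide^[n] x) := by
  induction n with
  | zero => exact spread_zero x
  | succ n ih =>
    rw [Function.iterate_succ_apply', Nat.cast_succ]
    exact ih.step

theorem mir_iterate_collide (x : Cfg) (n : ℕ) : mir (collide^[n] x) = collide^[n] (mir x) := by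
  induction n with
  | zero => rfl
  | succ n ih => rw [Function.iterate_succ_apply', Function.iterate_succ_apply', ← ih, collide_mir]

/-- The effect of the emission at the seeds `J`, as far as it concerns the right-hand sides. -/
structure Emits (J : ℤ → Prop) (y z : Cfg) : Prop where
  core : ∀ m, z m .core ↔ Domain J 0 m ∨ (¬ NearSeed J m ∧ y m .core)
  rFront : ∀ m, rFront z m → Exposed J (m - 22) ∨ (¬ NearSeed J m ∧ rFront y m)
  rLethal : ∀ m, Exposed J (m - 22) → z m .rLethal
  rBack : ∀ m, z m .rBack ↔ Exposed J (m - 16) ∨ (¬ NearSeed J m ∧ y m .rBack)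
  rPulse : ∀ m, z m .rPulse → ¬ NearSeed J m ∧ y m .rPulse
  lFront : ∀ m, lFront z m → Exposed (negSet J) (-m - 22) ∨ ¬ NearSeed J m
  lPulse : ∀ m, z m .lPulse → ¬ NearSeed J m

theorem nearSeed_negSet (J : ℤ → Prop) (m : ℤ) : NearSeed (negSet J) m ↔ NearSeed J (-m) := by
  have := within_neg J (m - 120) (m + 120)
  rw [show -(m + 120) = -m - 120 by ring, show -(m - 120) = -m + 120 by ring] at this
  exact this

theorem emits_emit (y : Cfg) : Emits (IsSeed y) y (emit y) where
  core _ := Iff.rfl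
  rFront m h := by
    rcases h with (h | h) | h
    · exact Or.inl h
    · exact Or.inr ⟨h.1, Or.inl h.2⟩
    · exact Or.inr ⟨h.1, Or.inr h.2⟩
  rLethal m h := Or.inl h
  rBack _ := Iff.rfl
  rPulse _ h := h
  lFront m h := by
    rcases h with (h | h) | h
    · exact Or.inl h
    · exact Or.inr h.1
    · exact Or.inr h.1
  lPulse _ h := h.1

theorem emits_mir_emit (y : Cfg) : Emits (negSet (IsSeed y)) (mir y) (mir (emit y)) where
  core m := by
    have h1 := domain_negSet (IsSeed y) 0 (-m)
    rw [neg_neg] at h1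
    rw [nearSeed_negSet, h1]
    exact Iff.rfl
  rFront m h := by
    rw [nearSeed_negSet]
    rcases h with (h | h) | h
    · rw [neg_neg] at h
      exact Or.inl h
    · exact Or.inr ⟨h.1, Or.inl h.2⟩
    · exact Or.inr ⟨h.1, Or.inr h.2⟩
  rLethal m h := by
    rw [← neg_neg m] at h
    exact Or.inl h
  rBack m := by
    rw [nearSeed_negSet]
    nth_rewrite 2 [← neg_neg m]
    exact Iff.rfl
  rPulse m h := by
    rw [nearSeed_negSet]
    exact h
  lFront m h := by
    rw [nearSeed_negSet, negSet_negSet]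
    rcases h with (h | h) | h
    · exact Or.inl h
    · exact Or.inr h.1
    · exact Or.inr h.1
  lPulse m h := by
    rw [nearSeed_negSet]
    exact h.1

theorem exposed_eq {J : ℤ → Prop} {i j : ℤ} (hi : Exposed J i) (hj : Exposed J j)
    (h1 : i - 44 ≤ j) (h2 : j ≤ i + 44) : j = i := by
  rcases lt_trichotomy i j with h | h | h
  · have := exposed_lt hi hj.1 h
    omega
  · exact h.symm
  · have := exposed_lt hj hi.1 h
    omega

theorem not_nearSeed {J : ℤ → Prop} {i m : ℤ} (hi : J i) (h : ¬ NearSeed J m) (h1 : i - 120 ≤ m)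
    (h2 : m ≤ i + 120) : False := h ⟨i, by omega, by omega, hi⟩

theorem nearSeed_of_domain {J : ℤ → Prop} {m : ℤ} (h : Domain J 0 m) : NearSeed J m := by
  obtain ⟨i, j, hi, hj, h1, h2, h3⟩ := h
  rcases le_or_gt m i with h4 | h4
  · exact ⟨i, by omega, by omega, hi⟩
  · exact ⟨j, by omega, by omega, hj⟩

theorem gap_emit {J : ℤ → Prop} {i : ℤ} (hi : Exposed J i) (m : ℤ) (h1 : i + 10 < m)
    (h2 : m ≤ i + 34) : Gap J 0 i m :=
  ⟨by omega, fun j hj hij => by have := exposed_lt hi hj hij; omega⟩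

/-- Near a seed only freshly emitted particles exist; away from all seeds the old ones have aged 14
steps, and 2 · 14 + 1 = 29 is the distance that `core_le` demands. -/
theorem Emits.half {J : ℤ → Prop} {y z : Cfg} (h : Emits J y z) (hs : Spread 14 y)
    (hfc : ∀ m, ParabolaCA.rFront y m → ¬ y m .core) (hpc : ∀ m, y m .rPulse → ¬ y m .core)
    (hbc : ∀ m, y m .rBack → ¬ y m .core) :
    Half J 0 z where
  back_le a b ha hb hba := by
    rcases h.rFront a ha with ha | ⟨ha, ha'⟩ <;> rcases (h.rBack b).1 hb with hb | ⟨hb, hb'⟩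
    · by_contra hc
      have := exposed_eq ha hb (by omega) (by omega)
      omega
    · by_contra hc
      exact not_nearSeed ha.1 hb (by omega) (by omega)
    · by_contra hc
      exact not_nearSeed hb.1 ha (by omega) (by omega)
    · have := hs.back_le _ _ ha' hb' hba
      omega
  core_le a q ha hq hqa := by
    obtain ⟨hq, hd⟩ := hq
    obtain ⟨hn, hq⟩ := ((h.core q).1 hq).resolve_left hd
    rcases h.rFront a ha with ha | ⟨ha, ha'⟩
    · by_contra hc
      exact not_nearSeed ha.1 hn (by omega) (by omega)
    · have := hs.core_le _ _ ha' hq hqa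
      omega
  front_core m hm hc := by
    rcases h.rFront m hm with hm | ⟨hm, hm'⟩ <;> rcases (h.core m).1 hc with hc | ⟨hc, hc'⟩
    · exact (gap_emit hm m (by omega) (by omega)).not_domain hm hc
    · exact not_nearSeed hm.1 hc (by omega) (by omega)
    · exact hm (nearSeed_of_domain hc)
    · exact hfc m hm' hc'
  pulse_core m hm hc := by
    obtain ⟨hm, hm'⟩ := h.rPulse m hm
    rcases (h.core m).1 hc with hc | ⟨hc, hc'⟩
    · exact hm (nearSeed_of_domain hc)
    · exact hpc m hm' hc'
  back_core m hm hc := by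
    rcases (h.rBack m).1 hm with hm | ⟨hm, hm'⟩ <;> rcases (h.core m).1 hc with hc | ⟨hc, hc'⟩
    · exact (gap_emit hm m (by omega) (by omega)).not_domain hm hc
    · exact not_nearSeed hm.1 hc (by omega) (by omega)
    · exact hm (nearSeed_of_domain hc)
    · exact hbc m hm' hc'
  gap_core i hi q hg hq := by
    obtain ⟨hn, -⟩ := ((h.core q).1 hq).resolve_left (hg.not_domain hi)
    have := hg.1
    by_contra hc
    exact not_nearSeed hi.1 hn (by omega) (by omega)
  gap_front i hi a hg ha := by
    have h1 := hg.1
    rcases h.rFront a ha with ha | ⟨ha, -⟩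
    · by_contra hc
      have := exposed_eq hi ha (by omega) (by omega)
      omega
    · by_contra hc
      exact not_nearSeed hi.1 ha (by omega) (by omega)
  gap_lethal i hi a hg ha := by
    have h1 := hg.1
    rcases h.lFront a (Or.inl ha) with ha | ha
    · have h2 : J (a + 22) := by
        have := ha.1
        rw [negSet, show -(-a - 22) = a + 22 by ring] at this
        exact this
      have := exposed_lt hi h2 (by omega)
      omega
    · by_contra hc
      exact not_nearSeed hi.1 ha (by omega) (by omega)
  gap_pulse i hi u a hg _ hu _ _ hux := by
    have h1 := hg.1
    exact (not_nearSeed hi.1 (h.lPulse u hu) (by omega) (by omega)).elim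
  far_pulse i hi u a hg _ hu _ hax _ := by
    have h1 := hg.1
    by_contra hc
    exact not_nearSeed hi.1 (h.lPulse u hu) (by omega) (by omega)
  front i hi _ := Or.inl (h.rLethal _ (by simpa using hi))
  back i hi _ := (h.rBack _).2 (Or.inl (by simpa using hi))
  ready i hi _ := Or.inl (h.rLethal _ (by simpa using hi))

theorem isSeed_iterate_collide (x : Cfg) (n : ℕ) : IsSeed (collide^[n] x) = IsSeed x := by
  induction n with
  | zero => rfl
  | succ n ih =>
    rw [Function.iterate_succ_apply', ← ih]
    rfl

theorem inv_emit (x : Cfg) : Inv (IsSeed x) 0 (emit (collide^[14] x)) := by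
  rw [← isSeed_iterate_collide x 14]
  have e : ∀ y : Cfg, collide^[14] y = collide (collide^[13] y) := fun y =>
    Function.iterate_succ_apply' _ _ _
  have key : ∀ y : Cfg, Spread 14 (collide^[14] y) ∧
      (∀ m, rFront (collide^[14] y) m → ¬ (collide^[14] y) m .core) ∧
      (∀ m, (collide^[14] y) m .rPulse → ¬ (collide^[14] y) m .core) ∧
      ∀ m, (collide^[14] y) m .rBack → ¬ (collide^[14] y) m .core := by
    intro y
    refine ⟨by simpa using spread_iterate y 14, ?_, ?_, ?_⟩
    · rw [e]
      exact Inv.front_core_step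
    · rw [e]
      exact Inv.pulse_core_step
    · rw [e]
      exact Inv.back_core_step
  have hr := key x
  have hl := key (mir x)
  rw [← mir_iterate_collide] at hl
  exact ⟨le_rfl, (emits_emit _).half hr.1 hr.2.1 hr.2.2.1 hr.2.2.2,
    (emits_mir_emit _).half hl.1 hl.2.1 hl.2.2.1 hl.2.2.2, fun m hm => Or.inl hm⟩

/-! ### The invariant along the orbit of the automaton -/

theorem Half.inner {J : ℤ → Prop} {t : ℤ} {x : Cfg} (h : Half J t x) : Half J t (inner x) :=
  ⟨h.back_le, h.core_le, h.front_core, h.pulse_core, h.back_core, h.gap_core, h.gap_front, h.gap_lethal,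
    h.gap_pulse, h.far_pulse, h.front, h.back, h.ready⟩

theorem Half.mir_inner {J : ℤ → Prop} {t : ℤ} {x : Cfg} (h : Half J t (mir x)) :
    Half J t (mir (ParabolaCA.inner x)) :=
  ⟨h.back_le, h.core_le, h.front_core, h.pulse_core, h.back_core, h.gap_core, h.gap_front, h.gap_lethal,
    h.gap_pulse, h.far_pulse, h.front, h.back, h.ready⟩

theorem Inv.inner {J : ℤ → Prop} {t : ℤ} {x : Cfg} (h : Inv J t x) :
    Inv J t (ParabolaCA.inner x) :=
  ⟨h.nonneg, h.right.inner, h.left.mir_inner, h.core⟩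

theorem emit_eq_self {x : Cfg} (h : ∀ m, ¬ x m .seed) : emit x = x := by
  have h0 : ∀ m, ¬ IsSeed x m := h
  have hn : ∀ m, ¬ NearSeed (IsSeed x) m := fun m ⟨j, _, _, hj⟩ => h j hj
  have hd : ∀ m, ¬ Domain (IsSeed x) 0 m := fun m ⟨i, _, hi, _⟩ => h i hi
  have he : ∀ m, ¬ Exposed (IsSeed x) m := fun m hm => h m hm.1
  have he' : ∀ m, ¬ Exposed (negSet (IsSeed x)) m := fun m hm => h (-m) hm.1
  have hw : ∀ a b, ¬ Within (IsSeed x) a b := fun a b ⟨j, _, _, hj⟩ => h j hj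
  funext m f
  cases f <;> simp [emit, h0, hn, hd, he, he', hw, h]

theorem parabolaCA_no_seed (x : Cfg) (m : ℤ) : ¬ (parabolaCA x) m .seed := fun h => h

theorem parabolaCA_eq {x : Cfg} (h : ∀ m, ¬ x m .seed) :
    parabolaCA x = collide^[14] (inner x) := by
  refine emit_eq_self fun m hm => ?_
  have := congrFun (isSeed_iterate_collide (inner x) 14) m
  exact h m (this ▸ hm : IsSeed (inner x) m)

theorem no_seed_iterate (x : Cfg) (n : ℕ) (m : ℤ) : ¬ (parabolaCA^[n + 1] x) m .seed := by
  rw [Function.iterate_succ_apply']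
  exact parabolaCA_no_seed _ m

theorem parabolaCA_iterate_succ (x : Cfg) (n : ℕ) :
    parabolaCA^[n + 2] x = collide^[14] (inner (parabolaCA^[n + 1] x)) := by
  rw [Function.iterate_succ_apply']
  exact parabolaCA_eq (no_seed_iterate x n)

theorem inv_iterate (x : Cfg) (n : ℕ) : Inv (IsSeed x) (14 * n) (parabolaCA^[n + 1] x) := by
  induction n with
  | zero =>
    rw [Nat.cast_zero, mul_zero]
    exact inv_emit (inner x)
  | succ n ih =>
    rw [parabolaCA_iterate_succ]
    have := ih.inner.iterate 14
    convert this using 1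
    push_cast
    ring

/-! ### The signals inside the core -/

/-- The cell `m` looks as in a basin from `j` on: solid up to `j + k`, a signal at `j + s` that runs
right if `d` and left otherwise, and a mark at `j + g`. -/
def Looks (x : Cfg) (j k s g : ℤ) (d : Bool) (m : ℤ) : Prop :=
  (x m .solid ↔ m ≤ j + k) ∧ (x m .sigR ↔ d = true ∧ m = j + s) ∧
    (x m .sigL ↔ d = false ∧ m = j + s) ∧ (x m .mark ↔ m = j + g)

/-- The site `m` belongs to the basin of the seed `j`. -/
def Basin (J : ℤ → Prop) (t : ℤ) (x : Cfg) (j m : ℤ) : Prop :=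
  j ≤ m ∧ (∀ i, J i → j < i → m < i) ∧ (x m .core → Domain J t m)

/-- Only sites of the basin are constrained, so `g` may be a fictitious position at or beyond the
next seed. -/
def Content (J : ℤ → Prop) (t : ℤ) (x : Cfg) (j k s g : ℤ) (d : Bool) : Prop :=
  ∀ m, Basin J t x j m → Looks x j k s g d m

theorem looks_far {x : Cfg} {j k s g m : ℤ} {d : Bool} (hk : j + k < m) (hs : j + s < m)
    (hg : j + g < m) : Looks x j k s g d m ↔
      ¬ x m .solid ∧ ¬ x m .sigR ∧ ¬ x m .sigL ∧ ¬ x m .mark := by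
  have h1 : ¬ m ≤ j + k := by omega
  have h2 : m ≠ j + s := by omega
  have h3 : m ≠ j + g := by omega
  simp [Looks, h1, h2, h3]

/-- Collisions only erase inner components, and never in the domain. A cell newly joining the domain
brings none along: foreign cores are more than 12 sites away, so it was not core, and cells that
were not core carry none after the step. -/
theorem Content.collide {J : ℤ → Prop} {t j k s g : ℤ} {d : Bool} {x : Cfg} (h : Inv J t x)
    (hj : J j) (hk : k ≤ 10 + t) (hs : s ≤ 10 + t) (hg : g ≤ 10 + t)
    (hc : Content J t x j k s g d) : Content J (t + 1) (collide x) j k s g d := by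
  have ht := h.nonneg
  rintro m ⟨h1, h2, h3⟩
  rcases le_or_gt m (j + 10 + t) with h4 | h4
  · have hd : Domain J t m := domain_of_seed hj (by omega) h4
    have hl := hc m ⟨h1, h2, fun _ => hd⟩
    have e1 := h.core m hd
    have e2 : newCore x m := h.domain_core_step (domain_mono hd)
    simpa only [Looks, ParabolaCA.collide, e1, e2, and_true] using hl
  · rw [looks_far (by omega) (by omega) (by omega)]
    have key : ∀ f : Fld, (Looks x j k s g d m → ¬ x m f) → ¬ (x m f ∧ x m .core ∧ newCore x m) := by
      rintro f hf ⟨e1, e2, e3⟩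
      have hd : Domain J t m := by
        by_contra hd
        obtain ⟨u, hu, h5, h6⟩ := h.exists_near (h3 e3)
        rcases lt_trichotomy u m with h7 | h7 | h7
        · have := h.fake_distance hu ⟨e2, hd⟩ h7
          omega
        · exact hd (h7 ▸ hu)
        · have := h.fake_distance' hu ⟨e2, hd⟩ h7
          omega
      exact hf (hc m ⟨h1, h2, fun _ => hd⟩) e1
    have hl := looks_far (x := x) (d := d) (j := j) (k := k) (s := s) (g := g) (m := m)
      (by omega) (by omega) (by omega)
    exact ⟨key _ fun e => (hl.1 e).1, key _ fun e => (hl.1 e).2.1, key _ fun e => (hl.1 e).2.2.1,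
      key _ fun e => (hl.1 e).2.2.2⟩

theorem Content.iterate_collide {J : ℤ → Prop} {t j k s g : ℤ} {d : Bool} {x : Cfg}
    (h : Inv J t x) (hj : J j) (hk : k ≤ 10 + t) (hs : s ≤ 10 + t) (hg : g ≤ 10 + t)
    (hc : Content J t x j k s g d) (n : ℕ) :
    Content J (t + n) (ParabolaCA.collide^[n] x) j k s g d := by
  induction n with
  | zero => simpa using hc
  | succ n ih =>
    rw [Function.iterate_succ_apply', Nat.cast_succ, ← add_assoc]
    exact ih.collide (h.iterate n) hj (by omega) (by omega) (by omega)

/-- The rules of the inner automaton in a basin, right of the solid cells. -/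
theorem inner_basin {J : ℤ → Prop} {t j k s g : ℤ} {d : Bool} {x : Cfg} (h : Inv J t x)
    (hk : 1 ≤ k) (hkg : k < g)
    (hwall : ∀ i, J i → x i .solid ∧ ¬ x i .sigL ∧ ¬ x i .mark)
    (hc : Content J t x j k s g d) {m : ℤ} (hm : j + k < m)
    (hnext : ∀ i, J i → j < i → m < i) (hd : Domain J t m) :
    (newSolid x m ↔ d = false ∧ m = j + s ∧ m - 1 ≤ j + k) ∧
    ((inner x) m .sigL ↔ ¬ newSolid x m ∧ ((d = false ∧ m + 1 = j + s ∧ ¬ J (m + 1)) ∨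
      (d = true ∧ m = j + s ∧ (m + 1 = j + g ∨ J (m + 1))))) ∧
    ((inner x) m .sigR ↔ ¬ newSolid x m ∧ ((d = true ∧ m - 1 = j + s ∧ m ≠ j + g) ∨
      (d = false ∧ m - 1 = j + s ∧ m - 2 ≤ j + k))) ∧
    ((inner x) m .mark ↔ ¬ newSolid x m ∧ ((m = j + g ∧ ¬ (d = true ∧ m - 1 = j + s)) ∨
      (m - 2 = j + g ∧ d = true ∧ m - 3 = j + s))) := by
  have hcore := h.core m hd
  have hb : ∀ u, j ≤ u → m - 3 ≤ u → u ≤ m → Looks x j k s g d u := by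
    intro u h1 h2 h3
    refine hc u ⟨h1, fun i hi hij => by have := hnext i hi hij; omega, fun hu => ?_⟩
    by_contra hud
    rcases lt_or_eq_of_le h3 with h4 | h4
    · have := h.fake_distance' hd ⟨hu, hud⟩ h4
      omega
    · exact hud (h4 ▸ hd)
  obtain ⟨a1, a2, a3, a4⟩ := hb m (by omega) (by omega) le_rfl
  obtain ⟨b1, b2, b3, b4⟩ := hb (m - 1) (by omega) (by omega) (by omega)
  obtain ⟨c1, c2, c3, c4⟩ := hb (m - 2) (by omega) (by omega) (by omega)
  have e : (x (m - 2) .mark ∧ x (m - 3) .sigR) ↔ m - 2 = j + g ∧ d = true ∧ m - 3 = j + s := by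
    rw [c4]
    refine and_congr_right fun h1 => ?_
    exact (hb (m - 3) (by omega) (by omega) (by omega)).2.1
  have f : (x (m + 1) .sigL ↔ d = false ∧ m + 1 = j + s ∧ ¬ J (m + 1)) ∧
      ((x (m + 1) .mark ∨ x (m + 1) .solid) ↔ m + 1 = j + g ∨ J (m + 1)) := by
    by_cases hJ : J (m + 1)
    · obtain ⟨w1, w2, w3⟩ := hwall _ hJ
      simp [hJ, w1, w2]
    · obtain ⟨d1, d2, d3, d4⟩ := hc (m + 1) ⟨by omega, fun i hi hij => by
        have := hnext i hi hij
        rcases eq_or_ne i (m + 1) with h1 | h1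
        · exact absurd (h1 ▸ hi) hJ
        · omega, fun hu => by
        by_contra hud
        have := h.fake_distance hd ⟨hu, hud⟩ (by omega)
        omega⟩
      have : ¬ (m + 1 ≤ j + k) := by omega
      rw [d1, d3, d4]
      simp [hJ, this]
  have a1' : ¬ x m .solid := fun h1 => by have := a1.1 h1; omega
  refine ⟨?_, ?_, ?_, ?_⟩
  · unfold newSolid
    rw [a3, b1]
    simp [a1', and_assoc]
  · change (x m .core ∧ ¬ newSolid x m ∧ _) ↔ _
    rw [f.1, f.2, a2]
    simp [hcore, and_assoc]
  · change (x m .core ∧ ¬ newSolid x m ∧ _) ↔ _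
    rw [b2, b3, c1, a4]
    simp [hcore, and_assoc]
  · change (x m .core ∧ ¬ newSolid x m ∧ _) ↔ _
    rw [e, b2, a4]
    simp [hcore]

/-- All geometry is settled here; `hrule` leaves each kind of move of the signal as arithmetic in
`j`, `k`, `s`, `g`. -/
theorem Content.inner {J : ℤ → Prop} {t j k s g k' s' g' : ℤ} {d d' : Bool} {x : Cfg}
    (h : Inv J t x) (hj : J j) (hk : 1 ≤ k) (hkg : k < g)
    (hkk : k ≤ k') (hks' : k' < s') (hkg' : k' < g')
    (ht2 : s' ≤ 10 + t) (ht3 : g' ≤ 10 + t)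
    (hwall : ∀ i, J i → x i .solid ∧ ¬ x i .sigL ∧ ¬ x i .mark)
    (hc : Content J t x j k s g d)
    (hrule : ∀ m, j + k < m → (∀ i, J i → j < i → m < i) →
      (newSolid x m ↔ d = false ∧ m = j + s ∧ m - 1 ≤ j + k) →
      ((newSolid x m ↔ m ≤ j + k') ∧
      ((¬ newSolid x m ∧ ((d = true ∧ m - 1 = j + s ∧ m ≠ j + g) ∨
        (d = false ∧ m - 1 = j + s ∧ m - 2 ≤ j + k))) ↔ d' = true ∧ m = j + s') ∧
      ((¬ newSolid x m ∧ ((d = false ∧ m + 1 = j + s ∧ ¬ J (m + 1)) ∨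
        (d = true ∧ m = j + s ∧ (m + 1 = j + g ∨ J (m + 1))))) ↔ d' = false ∧ m = j + s') ∧
      ((¬ newSolid x m ∧ ((m = j + g ∧ ¬ (d = true ∧ m - 1 = j + s)) ∨
        (m - 2 = j + g ∧ d = true ∧ m - 3 = j + s))) ↔ m = j + g'))) :
    Content J t (ParabolaCA.inner x) j k' s' g' d' := by
  rintro m ⟨h1, h2, h3⟩
  have h3' : x m .core → Domain J t m := h3
  by_cases hcore : x m .core
  · rcases le_or_gt m (j + k) with hm | hm
    · have hs : newSolid x m := Or.inl ((hc m ⟨h1, h2, h3'⟩).1.2 hm)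
      have e1 : m ≤ j + k' := by omega
      have e2 : m ≠ j + s' := by omega
      have e3 : m ≠ j + g' := by omega
      simp [Looks, ParabolaCA.inner, hcore, hs, e1, e2, e3]
    · obtain ⟨r1, r2, r3, r4⟩ := inner_basin h hk hkg hwall hc hm h2 (h3' hcore)
      obtain ⟨q1, q2, q3, q4⟩ := hrule m hm h2 r1
      refine ⟨?_, r3.trans q2, r2.trans q3, r4.trans q4⟩
      change (x m .core ∧ newSolid x m) ↔ _
      simpa [hcore] using q1
  · have hm : ¬ m ≤ j + 10 + t := fun hm => hcore
      (h.core m (domain_of_seed hj (by have := h.nonneg; omega) hm))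
    rw [looks_far (by omega) (by omega) (by omega)]
    simp [ParabolaCA.inner, hcore]

/-- The possible states of the basin of `j` at time `n`. -/
structure Phase (J : ℤ → Prop) (j n k s g : ℤ) (d : Bool) : Prop where
  one_le : 1 ≤ k
  le_time : k ≤ n
  lt_sig : k < s
  sig_le : s ≤ 2 * k + 1
  lt_mark : k < g
  mark_le : g ≤ 2 * k + 4
  -- Either the solid cells have reached the next seed, or the signal is under way. Without seeds on
  -- the right the time is exactly determined: with `k` solid cells the signal starts at `s = k + 1`
  -- at time `k² + k - 1`, turns at `s = 2k + 1` and is back at time `k² + 3k`. A reflection at the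
  -- next seed only saves time, hence the inequalities.
  state : (∃ i, J i ∧ j < i ∧ i ≤ j + k + 1) ∨
    ((∀ i, J i → j < i → j + s < i) ∧
      ((d = true ∧ s < g ∧ g ≤ 2 * k + 2 ∧ n ≤ k ^ 2 + s - 2 ∧
        ((∀ i, J i → i ≤ j) → g = 2 * k + 2 ∧ n = k ^ 2 + s - 2)) ∨
      (d = false ∧ s + 1 < g ∧ n ≤ k ^ 2 + 4 * k + 1 - s ∧
        ((∀ i, J i → i ≤ j) → g = 2 * k + 4 ∧ n = k ^ 2 + 4 * k + 1 - s))))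

theorem Phase.step {J : ℤ → Prop} {t j n k s g : ℤ} {d : Bool} {x : Cfg}
    (h : Inv J t x) (hj : J j) (hn : 1 ≤ n) (ht : t = 14 * (n - 1))
    (hwall : ∀ i, J i → x i .solid ∧ ¬ x i .sigL ∧ ¬ x i .mark)
    (hc : Content J t x j k s g d) (hp : Phase J j n k s g d) :
    ∃ k' s' g' d', Phase J j (n + 1) k' s' g' d' ∧ Content J t (inner x) j k' s' g' d' := by
  obtain ⟨p1, p2, p3, p4, p5, p6, p7⟩ := hp
  rcases p7 with ⟨i, hi, hij, hik⟩ | ⟨hact, ⟨hd, q1, q2, q3, q4⟩ | ⟨hd, q1, q3, q4⟩⟩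
  · refine ⟨k, s, g, d, ⟨p1, by omega, p3, p4, p5, p6, Or.inl ⟨i, hi, hij, hik⟩⟩, ?_⟩
    refine hc.inner h hj p1 p5 le_rfl p3 p5 (by omega) (by omega) hwall ?_
    intro m hm hnext
    have := hnext i hi hij
    omega
  · subst hd
    by_cases hturn : s + 1 = g ∨ J (j + s + 1)
    · by_cases hsg : s + 1 = g
      · refine ⟨k, s, g + 2, false, ⟨p1, by omega, p3, p4, by omega, by omega, Or.inr ⟨hact,
          Or.inr ⟨rfl, by omega, by omega, fun hl => ?_⟩⟩⟩, ?_⟩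
        · obtain ⟨e1, e2⟩ := q4 hl
          constructor <;> omega
        · refine hc.inner h hj p1 p5 le_rfl p3 (by omega) (by omega) (by omega)
            hwall ?_
          intro m hm hnext hS
          simp only [Bool.true_eq_false, false_and, iff_false] at hS
          refine ⟨?_, ?_, ?_, ?_⟩ <;> simp only [hS] <;> simp <;> omega
      -- The signal turns at the solid cell of the next seed, before the mark, which stays where it
      -- is.
      · have hJ := hturn.resolve_left hsg
        refine ⟨k, s, g, false, ⟨p1, by omega, p3, p4, by omega, by omega, Or.inr ⟨hact,
          Or.inr ⟨rfl, by omega, by omega, fun hl => ?_⟩⟩⟩, ?_⟩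
        · have := hl _ hJ
          omega
        · refine hc.inner h hj p1 p5 le_rfl p3 p5 (by omega) (by omega) hwall ?_
          intro m hm hnext hS
          have h1 := hnext _ hJ (by omega)
          simp only [Bool.true_eq_false, false_and, iff_false] at hS
          refine ⟨?_, ?_, ?_, ?_⟩ <;> simp only [hS] <;> simp
          · omega
          · omega
          · rintro rfl
            exact Or.inr hJ
          · omega
    · push Not at hturn
      obtain ⟨t1, t2⟩ := hturn
      refine ⟨k, s + 1, g, true, ⟨p1, by omega, by omega, by omega, by omega, by omega,
        Or.inr ⟨fun i hi hij => ?_, Or.inl ⟨rfl, by omega, by omega, by omega, fun hl => ?_⟩⟩⟩, ?_⟩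
      · have := hact i hi hij
        rcases eq_or_ne i (j + s + 1) with h1 | h1
        · exact absurd (h1 ▸ hi) t2
        · omega
      · obtain ⟨e1, e2⟩ := q4 hl
        constructor <;> omega
      · refine hc.inner h hj p1 p5 le_rfl (by omega) p5 (by omega) (by omega)
          hwall ?_
        intro m hm hnext hS
        simp only [Bool.true_eq_false, false_and, iff_false] at hS
        refine ⟨?_, ?_, ?_, ?_⟩ <;> simp only [hS] <;> simp
        · omega
        · omega
        · rintro rfl
          exact ⟨by omega, t2⟩
        · omega
  · subst hd
    -- Back at the solid segment, the signal turns its site into a solid cell and restarts to the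
    -- right of it.
    by_cases hgrow : s = k + 1
    · subst hgrow
      refine ⟨k + 1, k + 2, g, true, ⟨by omega, by omega, by omega, by omega, by omega, by omega,
        ?_⟩, ?_⟩
      · by_cases hex : ∃ i, J i ∧ j < i ∧ i ≤ j + (k + 1) + 1
        · exact Or.inl hex
        · push Not at hex
          refine Or.inr ⟨fun i hi hij => by have := hex i hi hij; omega, Or.inl ⟨rfl, by omega,
            by omega, by nlinarith, fun hl => ?_⟩⟩
          obtain ⟨e1, e2⟩ := q4 hl
          constructor
          · omega
          · rw [e2]
            ring
      · refine hc.inner h hj p1 p5 (by omega) (by omega) (by omega) (by omega) (by omega) hwall ?_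
        intro m hm hnext hS
        simp only [true_and] at hS
        refine ⟨?_, ?_, ?_, ?_⟩ <;> simp only [hS] <;> simp <;> omega
    · refine ⟨k, s - 1, g, false, ⟨p1, by omega, by omega, by omega, p5, p6, Or.inr
        ⟨fun i hi hij => by have := hact i hi hij; omega, Or.inr ⟨rfl, by omega, by omega,
        fun hl => ?_⟩⟩⟩, ?_⟩
      · obtain ⟨e1, e2⟩ := q4 hl
        constructor <;> omega
      · refine hc.inner h hj p1 p5 le_rfl (by omega) p5 (by omega) (by omega)
          hwall ?_
        intro m hm hnext hS
        simp only [true_and] at hS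
        refine ⟨?_, ?_, ?_, ?_⟩ <;> simp only [hS] <;> simp
        · omega
        · omega
        · constructor
          · omega
          · intro h1
            refine ⟨by omega, by omega, fun hJ => ?_⟩
            have := hact _ hJ (by omega)
            omega
        · omega

/-- A cell of the iterated collisions with inner components is a core cell. -/
theorem content_core_collide (x : Cfg) (m : ℤ) (f : Fld)
    (hf : f = .solid ∨ f = .sigR ∨ f = .sigL ∨ f = .mark) (h : (collide x) m f) :
    (collide x) m .core := by
  rcases hf with rfl | rfl | rfl | rfl <;> exact h.2.2

theorem content_emit (x : Cfg) (j : ℤ) (hj : IsSeed x j)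
    (hy : ∀ m f, f = .solid ∨ f = .sigR ∨ f = .sigL ∨ f = .mark → x m f → x m .core) :
    Content (IsSeed x) 0 (emit x) j 1 2 4 true := by
  rintro m ⟨h1, h2, h3⟩
  have hno : ∀ f, f = .solid ∨ f = .sigR ∨ f = .sigL ∨ f = .mark →
      ¬ (¬ NearSeed (IsSeed x) m ∧ x m f) := by
    rintro f hf ⟨e1, e2⟩
    exact e1 (nearSeed_of_domain (h3 (Or.inr ⟨e1, hy m f hf e2⟩)))
  have hle : ∀ i, IsSeed x i → i ≤ m → i ≤ j := fun i hi him => by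
    by_contra hc
    have := h2 i hi (by omega)
    omega
  have hw : ∀ c, Within (IsSeed x) (m - c) m ↔ m ≤ j + c := by
    intro c
    constructor
    · rintro ⟨i, e1, e2, hi⟩
      have := hle i hi e2
      omega
    · intro e
      exact ⟨j, by omega, h1, hj⟩
  have hs : ∀ c, 1 ≤ c → ((IsSeed x (m - c) ∧ ¬ Within (IsSeed x) (m - (c - 1)) m) ↔ m = j + c) := by
    intro c hc1
    rw [hw]
    constructor
    · rintro ⟨e1, e2⟩
      have := hle _ e1 (by omega)
      omega
    · rintro rfl
      exact ⟨by simpa using hj, by omega⟩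
  refine ⟨?_, ?_, ?_, ?_⟩
  · exact (or_iff_left (hno .solid (by simp))).trans (hw 1)
  · have h := (or_iff_left (hno .sigR (by simp))).trans (hs 2 (by norm_num))
    change (emit x) m .sigR ↔ true = true ∧ m = j + 2
    simp only [true_and]
    exact h
  · exact ⟨fun h => (hno .sigL (by simp) h).elim, fun h => by simp at h⟩
  · exact (or_iff_left (hno .mark (by simp))).trans (hs 4 (by norm_num))

theorem phase_one (J : ℤ → Prop) (j : ℤ) : Phase J j 1 1 2 4 true := by
  refine ⟨by norm_num, by norm_num, by norm_num, by norm_num, by norm_num, by norm_num, ?_⟩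
  by_cases hex : ∃ i, J i ∧ j < i ∧ i ≤ j + 1 + 1
  · exact Or.inl hex
  · push Not at hex
    exact Or.inr ⟨fun i hi hij => by have := hex i hi hij; omega, Or.inl (by norm_num)⟩

theorem exists_phase (x : Cfg) (n : ℕ) (j : ℤ) (hj : IsSeed x j) :
    ∃ k s g d, Phase (IsSeed x) j (n + 1) k s g d ∧
      Content (IsSeed x) (14 * n) (parabolaCA^[n + 1] x) j k s g d := by
  induction n generalizing j with
  | zero =>
    have e := isSeed_iterate_collide (inner x) 14
    have hc := content_emit (collide^[14] (inner x)) j (e ▸ hj) fun m f hf h => by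
      rw [Function.iterate_succ_apply'] at h ⊢
      exact content_core_collide _ m f hf h
    rw [e] at hc
    refine ⟨1, 2, 4, true, ?_, ?_⟩
    · rw [Nat.cast_zero, zero_add]
      exact phase_one _ j
    · rw [Nat.cast_zero, mul_zero]
      exact hc
  | succ n ih =>
    have hI := inv_iterate x n
    have hwall : ∀ i, IsSeed x i → (parabolaCA^[n + 1] x) i .solid ∧
        ¬ (parabolaCA^[n + 1] x) i .sigL ∧ ¬ (parabolaCA^[n + 1] x) i .mark := by
      intro i hi
      obtain ⟨k, s, g, d, hp, hc⟩ := ih i hi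
      have h1 := hp.one_le
      have h2 := hp.lt_sig
      have h3 := hp.lt_mark
      obtain ⟨l1, l2, l3, l4⟩ := hc i ⟨le_rfl, fun _ _ h => h, fun _ =>
        domain_of_seed hi (by omega) (by omega)⟩
      refine ⟨l1.2 (by omega), fun h => ?_, fun h => ?_⟩
      · have := (l3.1 h).2
        omega
      · have := l4.1 h
        omega
    obtain ⟨k, s, g, d, hp, hc⟩ := ih j hj
    obtain ⟨k', s', g', d', hp', hc'⟩ := hp.step hI hj (by omega) (by ring) hwall hc
    refine ⟨k', s', g', d', by rw [Nat.cast_succ]; exact hp', ?_⟩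
    rw [parabolaCA_iterate_succ]
    have h1 := hp'.le_time
    have h2 := hp'.sig_le
    have h3 := hp'.mark_le
    have := hc'.iterate_collide hI.inner hj (by omega) (by omega) (by omega) 14
    convert this using 1
    push_cast
    ring

/-! ### The parabola -/

theorem le_parabola_iff (k : ℤ) (hk : 0 ≤ k) (n : ℕ) : k ≤ parabola n ↔ k * (k + 1) ≤ n + 1 := by
  have hk' : (0 : ℝ) ≤ k := by exact_mod_cast hk
  rw [parabola, Int.le_floor, le_div_iff₀ (by norm_num), le_sub_iff_add_le,
    Real.le_sqrt (by positivity) (by positivity)]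
  have e : ((k : ℝ) * 2 + 1) ^ 2 ≤ 1 + 4 * ((n : ℝ) + 1) ↔ (k : ℝ) * (k + 1) ≤ n + 1 := by
    constructor <;> intro h <;> nlinarith
  rw [e]
  exact_mod_cast Iff.rfl

theorem parabola_nonneg (n : ℕ) : 0 ≤ parabola n := by
  rw [le_parabola_iff 0 le_rfl]
  positivity

theorem parabola_zero : parabola 0 = 0 := by
  have h : ¬ 1 ≤ parabola 0 := by
    rw [le_parabola_iff 1 (by norm_num)]
    norm_num
  have := parabola_nonneg 0
  omega

theorem Phase.parabola_le {J : ℤ → Prop} {j k s g : ℤ} {d : Bool} {n : ℕ}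
    (hp : Phase J j (n + 1) k s g d) {m : ℤ} (hm : m ≤ j + parabola (n + 1))
    (hnext : ∀ i, J i → j < i → m < i) : m ≤ j + k := by
  obtain ⟨p1, p2, p3, p4, p5, p6, p7⟩ := hp
  rcases p7 with ⟨i, hi, hij, hik⟩ | ⟨hact, hst⟩
  · have := hnext i hi hij
    omega
  -- As long as only `k` cells are solid, the time is at most `k² + 3k`, short of `(k + 1)(k + 2) -
  -- 1`.
  · have h : ¬ k + 1 ≤ parabola (n + 1) := by
      rw [le_parabola_iff _ (by omega)]
      push_cast
      rcases hst with ⟨-, q1, q2, q3, -⟩ | ⟨-, q1, q3, -⟩ <;> nlinarith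
    omega

theorem Phase.le_parabola {J : ℤ → Prop} {j k s g : ℤ} {d : Bool} {n : ℕ}
    (hp : Phase J j (n + 1) k s g d) (hl : ∀ i, J i → i ≤ j) : k ≤ parabola (n + 1) := by
  obtain ⟨p1, p2, p3, p4, p5, p6, p7⟩ := hp
  rw [le_parabola_iff _ (by omega)]
  push_cast
  rcases p7 with ⟨i, hi, hij, -⟩ | ⟨-, ⟨-, q1, q2, q3, q4⟩ | ⟨-, q1, q3, q4⟩⟩
  · have := hl i hi
    omega
  · have := (q4 hl).2
    nlinarith
  · have := (q4 hl).2
    nlinarith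

/-- The letter that starts the construction. -/
def seedCell : Cell := fun f => f = .seed

def solidCell : Cell := fun f => f = .core ∨ f = .solid

/-- The last seed `i` in `[j, m]` does the work: `m` is no farther from `i` than from `j`, and no
seed separates them. Particles avoid core cells, and signal and mark lie beyond the solid cells, so
the whole cell is determined. -/
theorem eq_solidCell (x : Cfg) (n : ℕ) {j m : ℤ} (hj : IsSeed x j) (hjm : j ≤ m)
    (hm : m ≤ j + parabola (n + 1)) : (parabolaCA^[n + 1] x) m = solidCell := by
  obtain ⟨i, ⟨hi, him⟩, hmax⟩ := Int.exists_greatest_of_bdd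
    (P := fun i => IsSeed x i ∧ i ≤ m) ⟨m, fun z hz => hz.2⟩ ⟨j, hj, hjm⟩
  have hji := hmax j ⟨hj, hjm⟩
  have hnext : ∀ k, IsSeed x k → i < k → m < k := fun k hk hik => by
    by_contra hc
    have := hmax k ⟨hk, by omega⟩
    omega
  obtain ⟨k, s, g, d, hp, hc⟩ := exists_phase x n i hi
  have hI := inv_iterate x n
  have h0 := hp.parabola_le (m := m) (by omega) hnext
  have h1 := hp.le_time
  have h2 := hp.lt_sig
  have h3 := hp.lt_mark
  have hd : Domain (IsSeed x) (14 * n) m := domain_of_seed hi (by omega) (by omega)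
  have hcore := hI.core m hd
  obtain ⟨l1, l2, l3, l4⟩ := hc m ⟨him, hnext, fun _ => hd⟩
  have hlf : ¬ lFront (parabolaCA^[n + 1] x) m := fun h => hI.left_front_core h hcore
  have hrf : ¬ rFront (parabolaCA^[n + 1] x) m := fun h => hI.right.front_core m h hcore
  unfold lFront at hlf
  unfold rFront at hrf
  push Not at hlf hrf
  have hlb : ¬ (parabolaCA^[n + 1] x) m .lBack := fun h => by
    have := hI.left.back_core (-m) (by simpa [mir, Fld.swap] using h)
    simp [mir, Fld.swap, hcore] at this
  have e1 : m ≠ i + s := by omega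
  have e2 : m ≠ i + g := by omega
  funext f
  apply propext
  cases f
  case core => simp [solidCell, hcore]
  case solid => simp [solidCell, l1, h0]
  case sigR => simp [solidCell, l2, e1]
  case sigL => simp [solidCell, l3, e1]
  case mark => simp [solidCell, l4, e2]
  case seed => simpa [solidCell] using no_seed_iterate x n m
  case rLethal => simp [solidCell, hrf.1]
  case rHarmless => simp [solidCell, hrf.2]
  case rBack => simpa [solidCell] using fun h => hI.right.back_core m h hcore
  case rPulse => simpa [solidCell] using fun h => hI.right.pulse_core m h hcore
  case lLethal => simp [solidCell, hlf.1]
  case lHarmless => simp [solidCell, hlf.2]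
  case lBack => simpa [solidCell] using hlb
  case lPulse => simpa [solidCell] using fun h => hI.left_pulse_core h hcore

/-! ### Configurations that are blank outside an interval -/

theorem core_iterate_collide (x : Cfg) (n : ℕ) (m : ℤ) (h : (collide^[n] x) m .core) :
    ∃ q, m - n ≤ q ∧ q ≤ m + n ∧ x q .core := by
  induction n generalizing m with
  | zero => exact ⟨m, by simp, by simp, h⟩
  | succ n ih =>
    rw [Function.iterate_succ_apply'] at h
    obtain ⟨⟨p, h1, h2, hp⟩, -⟩ := h
    obtain ⟨q, h3, h4, hq⟩ := ih p hp
    exact ⟨q, by push_cast; omega, by push_cast; omega, hq⟩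

theorem content_iterate_collide (x : Cfg) (n : ℕ) (m : ℤ) (f : Fld)
    (hf : f = .solid ∨ f = .sigR ∨ f = .sigL ∨ f = .mark) (h : (collide^[n] x) m f) : x m f := by
  induction n with
  | zero => exact h
  | succ n ih =>
    rw [Function.iterate_succ_apply'] at h
    apply ih
    rcases hf with rfl | rfl | rfl | rfl <;> exact h.1

section Blank

variable {x : Cfg} {i j : ℤ}

/-- An initial core spreads by at most 14 sites before the emission; to the right of `j` it is still
near that seed and is erased. Afterwards cores grow no faster than the domain. -/
theorem core_domain_of_blank (hj : IsSeed x j)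
    (hb : ∀ m f, x m f → i ≤ m ∧ m ≤ j) (n : ℕ) (m : ℤ) (hm : j ≤ m)
    (hc : (parabolaCA^[n + 1] x) m .core) : Domain (IsSeed x) (14 * n) m := by
  induction n generalizing m with
  | zero =>
    rw [Nat.cast_zero, mul_zero]
    have e := isSeed_iterate_collide (inner x) 14
    change Domain (IsSeed (collide^[14] (inner x))) 0 m ∨
      (¬ NearSeed (IsSeed (collide^[14] (inner x))) m ∧ _) at hc
    rw [e] at hc
    rcases hc with hc | ⟨hc, hc'⟩
    · exact hc
    · obtain ⟨q, h1, h2, hq⟩ := core_iterate_collide _ _ _ hc'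
      have := hb q .core hq
      push_cast at h1 h2
      exact (hc ⟨j, by omega, by omega, hj⟩).elim
  | succ n ih =>
    rw [parabolaCA_iterate_succ] at hc
    have key : ∀ (l : ℕ) (m : ℤ), j ≤ m → (collide^[l] (inner (parabolaCA^[n + 1] x))) m .core →
        Domain (IsSeed x) (14 * n + l) m := by
      intro l
      induction l with
      | zero =>
        intro m hm hc
        rw [Nat.cast_zero, add_zero]
        exact ih m hm hc
      | succ l ihl =>
        intro m hm hc
        rw [Function.iterate_succ_apply'] at hc
        obtain ⟨⟨p, h1, h2, hp⟩, -⟩ := hc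
        rcases le_or_gt j p with h3 | h3
        · obtain ⟨a, b, ha, hb, h4, h5, h6⟩ := ihl p h3 hp
          exact ⟨a, b, ha, hb, h4, by push_cast; omega, by push_cast; omega⟩
        · exact domain_of_seed hj (by push_cast; omega) (by push_cast; omega)
    have := key 14 m hm hc
    convert this using 1
    push_cast
    ring

theorem content_of_blank (hi : IsSeed x i) (hb : ∀ m f, x m f → i ≤ m ∧ m ≤ j) (n : ℕ) (m : ℤ)
    (hm : m < i) (f : Fld) (hf : f = .solid ∨ f = .sigR ∨ f = .sigL ∨ f = .mark) :
    ¬ (parabolaCA^[n + 1] x) m f := by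
  induction n generalizing m f with
  | zero =>
    intro h
    have e := isSeed_iterate_collide (inner x) 14
    have hs : ∀ k, IsSeed (collide^[14] (inner x)) k → i ≤ k := by
      rw [e]
      exact fun k hk => (hb k _ hk).1
    have hin : ¬ (collide^[14] (inner x)) m f := fun h => by
      have h1 := content_iterate_collide _ _ _ _ hf h
      have h2 : x m .core := by
        rcases hf with rfl | rfl | rfl | rfl <;> exact h1.1
      have := (hb m _ h2).1
      omega
    change (emit (collide^[14] (inner x))) m f at h
    rcases hf with rfl | rfl | rfl | rfl
    · rcases h with ⟨k, h1, h2, hk⟩ | h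
      · have := hs k hk
        omega
      · exact hin h.2
    · rcases h with h | h
      · have := hs _ h.1
        omega
      · exact hin h.2
    · exact hin h.2
    · rcases h with h | h
      · have := hs _ h.1
        omega
      · exact hin h.2
  | succ n ih =>
    intro h
    rw [parabolaCA_iterate_succ] at h
    have h' := content_iterate_collide _ _ _ _ hf h
    have s0 := ih m hm .solid (by simp)
    have s1 := ih m hm .sigR (by simp)
    have s2 := ih m hm .sigL (by simp)
    have s3 := ih m hm .mark (by simp)
    have t1 := ih (m - 1) (by omega) .sigR (by simp)
    have t2 := ih (m - 1) (by omega) .sigL (by simp)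
    have t3 := ih (m - 2) (by omega) .mark (by simp)
    -- Only a signal running left could leave the region across `i`, and the site `i` is solid at
    -- all positive times.
    have t4 : ¬ (parabolaCA^[n + 1] x) (m + 1) .sigL := by
      rcases eq_or_ne (m + 1) i with h1 | h1
      · rw [h1, eq_solidCell x n hi le_rfl (by have := parabola_nonneg (n + 1); omega)]
        simp [solidCell]
      · exact ih (m + 1) (by omega) .sigL (by simp)
    rcases hf with rfl | rfl | rfl | rfl
    · exact h'.2.elim s0 fun h => s2 h.1
    · rcases h'.2.2 with h | h
      · exact t1 h.1
      · exact t2 h.1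
    · rcases h'.2.2 with h | h
      · exact t4 h
      · exact s1 h.1
    · rcases h'.2.2 with h | h
      · exact s3 h.1
      · exact t3 h.1

theorem not_solid_of_blank (hi : IsSeed x i) (hj : IsSeed x j)
    (hb : ∀ m f, x m f → i ≤ m ∧ m ≤ j) (n : ℕ) (m : ℤ)
    (hm : m < i ∨ j + parabola (n + 1) < m) : ¬ (parabolaCA^[n + 1] x) m .solid := by
  rcases hm with hm | hm
  · exact content_of_blank hi hb n m hm .solid (by simp)
  · have hl : ∀ k, IsSeed x k → k ≤ j := fun k hk => (hb k _ hk).2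
    have h0 := parabola_nonneg (n + 1)
    obtain ⟨k, s, g, d, hp, hc⟩ := exists_phase x n j hj
    have h1 := hp.le_parabola hl
    intro h
    have := (hc m ⟨by omega, fun k hk hjk => by have := hl k hk; omega,
      core_domain_of_blank hj hb n m (by omega)⟩).1.1 h
    omega

end Blank

end ParabolaCA

end CurveDynamics

namespace CurveDynamics

/-! ### The Cantor distance as agreement on a central window -/

section Metric

variable {A : Type*}

theorem eq_of_cantorDist_lt {x y : ℤ → A} {k : ℕ} (h : cantorDist x y < (2 : ℝ)⁻¹ ^ k) {i : ℤ}
    (hi : i.natAbs ≤ k) : x i = y i := by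
  by_contra hne
  have hxy : x ≠ y := fun e => hne (congrFun e i)
  have hle : sInf {n : ℕ | ∃ i : ℤ, i.natAbs = n ∧ x i ≠ y i} ≤ k :=
    le_trans (Nat.sInf_le ⟨i, rfl, hne⟩) hi
  rw [cantorDist, if_neg hxy] at h
  exact h.not_ge (pow_le_pow_of_le_one (by norm_num) (by norm_num) hle)

theorem cantorDist_lt_of_eq {x y : ℤ → A} {k : ℕ} (h : ∀ i : ℤ, i.natAbs ≤ k → x i = y i) :
    cantorDist x y < (2 : ℝ)⁻¹ ^ k := by
  by_cases hxy : x = y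
  · rw [cantorDist, if_pos hxy]
    positivity
  · rw [cantorDist, if_neg hxy]
    obtain ⟨i, hi⟩ := Function.ne_iff.1 hxy
    refine pow_lt_pow_right_of_lt_one₀ (by norm_num) (by norm_num) ?_
    obtain ⟨l, hl, hne⟩ := Nat.sInf_mem (s := {n : ℕ | ∃ i : ℤ, i.natAbs = n ∧ x i ≠ y i})
      ⟨_, i, rfl, hi⟩
    by_contra hc
    exact hne (h l (by omega))

theorem exists_two_inv_pow_lt {ε : ℝ} (hε : 0 < ε) : ∃ k : ℕ, (2 : ℝ)⁻¹ ^ k < ε :=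
  exists_pow_lt_of_lt_one hε (by norm_num)

theorem shift_eq (m : ℤ) (x : ℤ → A) (i : ℤ) :
    SymbolicDynamics.FullShift.shift m x i = x (m + i) := by
  simp [SymbolicDynamics.FullShift.shift]

end Metric

/-! ### Cone of consequences and equicontinuous curves -/

namespace ParabolaCA

/-- The configuration with the letter `seedCell` on the set `S` that is blank elsewhere. -/
def seeds (S : Set ℤ) : Cfg := fun m f => m ∈ S ∧ f = .seed

theorem seeds_of_mem {S : Set ℤ} {m : ℤ} (h : m ∈ S) : seeds S m = seedCell := by
  funext f
  simp [seeds, seedCell, h]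

theorem isSeed_update (x : Cfg) (m : ℤ) : IsSeed (Function.update x m seedCell) m := by
  simp [IsSeed, seedCell]

/-- Outside the reach of the seeds, a configuration that is blank outside an interval can be
told apart from the one that has another seed there. -/
theorem iterate_update_ne {x : Cfg} {i j : ℤ} (hi : IsSeed x i) (hj : IsSeed x j)
    (hb : ∀ m f, x m f → i ≤ m ∧ m ≤ j) (n : ℕ) (m : ℤ) (hm : m < i ∨ j + parabola n < m) :
    (parabolaCA^[n] x) m ≠ (parabolaCA^[n] (Function.update x m seedCell)) m := by
  intro h
  cases n with
  | zero =>
    rw [parabola_zero] at hm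
    have h1 : x m .seed := by
      simp only [Function.iterate_zero, id_eq, Function.update_self] at h
      rw [h]
      rfl
    have := hb m _ h1
    omega
  | succ n =>
    have h0 := parabola_nonneg (n + 1)
    have h1 := eq_solidCell (Function.update x m seedCell) n (isSeed_update x m) le_rfl
      (by omega)
    refine not_solid_of_blank hi hj hb n m hm ?_
    rw [h, h1]
    exact Or.inr rfl

theorem consequences_seedCell : consequences parabolaCA (wordCylinder [seedCell] 0) =
    {s : ℤ × ℕ | 0 ≤ s.1 ∧ s.1 ≤ parabola s.2} := by
  have hcyl : ∀ x : Cfg, x ∈ wordCylinder [seedCell] 0 ↔ x 0 = seedCell := by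
    intro x
    constructor
    · intro h
      simpa using h ⟨0, by simp⟩
    · rintro h ⟨j, hj⟩
      obtain rfl : j = 0 := by simpa using hj
      simpa using h
  ext ⟨m, n⟩
  constructor
  · intro h
    by_contra hout
    have hx : IsSeed (seeds {0}) 0 := ⟨rfl, rfl⟩
    have hm : m < 0 ∨ 0 + parabola n < m := by
      by_contra hc
      exact hout ⟨by omega, by simp only; omega⟩
    have hne := iterate_update_ne hx hx (fun q f hq => by
      obtain rfl : q = 0 := hq.1
      simp) n m hm
    have h0 := parabola_nonneg n
    apply hne
    have := h (seeds {0}) ((hcyl _).2 (seeds_of_mem rfl)) (Function.update (seeds {0}) m seedCell)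
      ((hcyl _).2 (by rw [Function.update_of_ne (by omega)]; exact seeds_of_mem rfl))
    simpa only [shift_eq, add_zero] using this
  · rintro ⟨h1, h2⟩ x hx y hy
    simp only at h1 h2
    rw [hcyl] at hx hy
    simp only [shift_eq, add_zero]
    cases n with
    | zero =>
      rw [parabola_zero] at h2
      obtain rfl : m = 0 := by omega
      exact hx.trans hy.symm
    | succ n =>
      have hsx : IsSeed x 0 := by rw [IsSeed, hx]; rfl
      have hsy : IsSeed y 0 := by rw [IsSeed, hy]; rfl
      rw [eq_solidCell x n hsx h1 (by omega), eq_solidCell y n hsy h1 (by omega)]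

theorem mem_equicontinuousPoints_seedCell {h : ℕ → ℤ} (h0 : CurveLE (fun _ => 0) h)
    (hp : CurveLE h parabola) :
    (fun _ => seedCell) ∈ equicontinuousPoints Set.univ parabolaCA h := by
  obtain ⟨M, hM, h0⟩ := h0
  obtain ⟨N, hN, hp⟩ := hp
  refine ⟨trivial, fun ε hε => ?_⟩
  obtain ⟨r, hr⟩ := exists_two_inv_pow_lt hε
  -- The seeds on `[-k, k]` force solid cells on `[-k, k + p(n)]`, which contains the window of
  -- radius `r` around `h n`.
  set k : ℕ := M.toNat + N.toNat + r with hk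
  refine ⟨2⁻¹ ^ k, by positivity, ?_⟩
  rintro y ⟨-, hy⟩
  refine ⟨trivial, fun n => (cantorDist_lt_of_eq fun i hi => ?_).trans hr⟩
  have hy' : ∀ i : ℤ, i.natAbs ≤ k → seedCell = y i := fun i => eq_of_cantorDist_lt hy
  have e1 := h0 n
  have e2 := hp n
  simp only at e1
  rw [shift_eq, shift_eq]
  cases n with
  | zero =>
    rw [parabola_zero] at e2
    exact hy' _ (by omega)
  | succ n =>
    have key : ∀ z : Cfg, (∀ i : ℤ, i.natAbs ≤ k → seedCell = z i) →
        (parabolaCA^[n + 1] z) (h (n + 1) + i) = solidCell := by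
      intro z hz
      have hs : ∀ i : ℤ, i.natAbs ≤ k → IsSeed z i := fun i hi => by
        rw [IsSeed, ← hz i hi]
        rfl
      have hpn := parabola_nonneg (n + 1)
      rcases le_or_gt (h (n + 1) + i) k with hle | hlt
      · exact eq_solidCell z n (hs _ (by omega)) le_rfl (by omega)
      · exact eq_solidCell z n (hs k (by omega)) hlt.le (by omega)
    rw [key _ fun _ _ => rfl, key y hy']

/-- The central part of `x` that decides the cell at `h n` is enclosed between two seeds in an
otherwise blank configuration. If `h n` escaped the reach of the seeds, one more seed placed at `h
n` would change that cell, although the central part is the same. -/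
theorem curveLE_of_mem_equicontinuousPoints {h : ℕ → ℤ} {x : Cfg}
    (hx : x ∈ equicontinuousPoints Set.univ parabolaCA h) :
    CurveLE (fun _ => 0) h ∧ CurveLE h parabola := by
  -- Distance less than 1 means agreement at the site 0 of the shifted configurations, that is, at
  -- `h n`.
  obtain ⟨δ, hδ, hsub⟩ := hx.2 1 one_pos
  obtain ⟨k, hk⟩ := exists_two_inv_pow_lt hδ
  set l : ℤ := k + 1 with hl
  set y : Cfg := fun m f => (m.natAbs ≤ k ∧ x m f) ∨ (m.natAbs = k + 1 ∧ f = .seed) with hy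
  have htube : ∀ z : Cfg, (∀ i : ℤ, i.natAbs ≤ k → x i = z i) → ∀ n,
      (parabolaCA^[n] x) (h n) = (parabolaCA^[n] z) (h n) := by
    intro z hz n
    have h1 := (hsub ⟨trivial, (cantorDist_lt_of_eq hz).trans hk⟩).2 n
    have h2 := eq_of_cantorDist_lt (k := 0) (i := 0) (by simpa using h1) (by simp)
    simpa only [shift_eq, add_zero] using h2
  have hy1 : ∀ i : ℤ, i.natAbs ≤ k → x i = y i := by
    intro i hi
    have : i.natAbs ≠ k + 1 := by omega
    funext f
    simp [hy, hi, this]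
  have hi : IsSeed y (-l) := Or.inr ⟨by omega, rfl⟩
  have hj : IsSeed y l := Or.inr ⟨by omega, rfl⟩
  have hb : ∀ m f, y m f → -l ≤ m ∧ m ≤ l := by
    rintro m f (⟨h1, -⟩ | ⟨h1, -⟩) <;> omega
  have main : ∀ n, -l ≤ h n ∧ h n ≤ l + parabola n := by
    intro n
    by_contra hc
    have hpn := parabola_nonneg n
    have hm : h n < -l ∨ l + parabola n < h n := by omega
    refine iterate_update_ne hi hj hb n (h n) hm ?_
    rw [← htube y hy1 n]
    refine htube _ (fun i hi => ?_) n
    rw [Function.update_of_ne (by omega), hy1 i hi]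
  refine ⟨⟨l, by omega, fun n => ?_⟩, ⟨l, by omega, fun n => ?_⟩⟩
  · have := main n
    simp only
    omega
  · have := main n
    omega

theorem equicontinuousCurves_parabolaCA : equicontinuousCurves Set.univ parabolaCA =
    {h | h ∈ boundedVariationCurves ∧ CurveLE (fun _ => 0) h ∧ CurveLE h parabola} := by
  ext h
  constructor
  · rintro ⟨h1, x, hx⟩
    exact ⟨h1, curveLE_of_mem_equicontinuousPoints hx⟩
  · rintro ⟨h1, h2, h3⟩
    exact ⟨h1, _, mem_equicontinuousPoints_seedCell h2 h3⟩

end ParabolaCA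

end CurveDynamics

theorem mainTheorem3 :
    ∃ (A : Type) (_ : Finite A) (F : (ℤ → A) → (ℤ → A)),
      CurveDynamics.IsCellularAutomaton F ∧
      CurveDynamics.equicontinuousCurves Set.univ F =
        {h | h ∈ CurveDynamics.boundedVariationCurves ∧
          CurveDynamics.CurveLE (fun _ => 0) h ∧
          CurveDynamics.CurveLE h CurveDynamics.parabola} ∧
      ∃ a : A,
        CurveDynamics.consequences F (CurveDynamics.wordCylinder [a] 0) =
          {s : ℤ × ℕ | 0 ≤ s.1 ∧ s.1 ≤ CurveDynamics.parabola s.2} :=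
  ⟨CurveDynamics.ParabolaCA.Cell, inferInstance, CurveDynamics.ParabolaCA.parabolaCA,
    CurveDynamics.ParabolaCA.isLoc_parabolaCA.isCellularAutomaton,
    CurveDynamics.ParabolaCA.equicontinuousCurves_parabolaCA, CurveDynamics.ParabolaCA.seedCell,
    CurveDynamics.ParabolaCA.consequences_seedCell⟩
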